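/- Let $d\ge 2$ and, for $k>0$, let $$\Phi_k(x,y)=\frac{\mathrm i}{4}\Big(\frac{k}{2\pi|x-y|}\Big)^{(d-2)/2}H^{(1)}_{d/2-1}(k|x-y|)$$ be the outgoing fundamental solution of the Helmholtz equation in $\mathbb R^d$ (so $\Phi_k=\frac{\mathrm i}{4}H_0^{(1)}(k|x-y|)$ for $d=2$ and $\Phi_k=\mathrm e^{\mathrm ik|x-y|}/(4\pi|x-y|)$ for $d=3$). For a hypersurface $\Gamma\subset\mathbb R^d$ with surface measure $\mathrm ds$ let $S_k\phi(x)=\int_\Gamma\Phi_k(x,y)\phi(y)\,\mathrm ds(y)$ be the single-layer operator. Write $x'=(x_1,x'')\in\mathbb R\times\mathbb R^{d-2}$. On a graph $\Gamma=\{(x',g(x')):|x'|<1\}$ use $x'$ as coordinates, so that $\partial_{x_i}v$ means the derivative of $x'\mapsto v(x',g(x'))$ in $x_i$, and let $\|v\|_{H^1(\Gamma)}^2=\|v\|_{L^2(\Gamma)}^2+\sum_{i=1}^{d-1}\|\partial_{x_i}v\|_{L^2(\Gamma)}^2$ (weak derivatives; $\|v\|_{H^1(\Gamma)}=\infty$ if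 $v\notin H^1(\Gamma)$). Let $\chi\in C_c^\infty(\mathbb R)$ with $\chi\ge 0$, $\operatorname{supp}\chi\subset[-2,2]$, $\chi\equiv 1$ on $[-1,1]$, and put $$u_{\epsilon,\gamma_1,\gamma_2,k}(x)=\mathrm e^{\mathrm ikx_1}\,\chi(\epsilon^{-1}k^{\gamma_1}x_1)\,\chi(\epsilon^{-1}k^{\gamma_2}|x''|).$$ (1) Flat case: let $\Gamma=\{(x',0):|x'|<1\}$ and $u=u_{\epsilon,0,1/2,k}$. There is $\epsilon_0>0$ such that for every $\epsilon\in(0,\epsilon_0)$ there are $c>0$ and $k_0>0$ such that, for all $k\ge k_0$, $0<\|u\|_{L^2(\Gamma)}<\infty$ and $$\|S_ku\|_{L^2(\Gamma)}\ge c\,k^{-1/2}\|u\|_{L^2(\Gamma)},\qquad \|\partial_{x_1}S_ku\|_{L^2(\Gamma)}\ge c\,k^{1/2}\|u\|_{L^2(\Gamma)},$$ where the last bound holds both for the classical derivative (counted as $0$ wherever it does not exist) and for every weak derivative $\partial_{x_1}S_ku$. Consequently the power $1/2$ in the bound $\|S_k\|_{L^2(\Gamma)\to H^1(\Gamma)}\lesssim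 k^{1/2}\log k$ is optimal: if $s,C,k_0\in\mathbb R$ are such that $\|S_kv\|_{H^1(\Gamma)}\le C\,k^{s}\log k\,\|v\|_{L^2(\Gamma)}$ for all $k\ge k_0$ and all $v\in L^2(\Gamma)$, then $s\ge 1/2$. (2) Curved case: let $\Gamma=\{(x',|x'|^2):|x'|<1\}$ and $u=u_{\epsilon,1/3,2/3,k}$. There is $\epsilon_0>0$ such that for every $\epsilon\in(0,\epsilon_0)$ there are $c>0$ and $k_0>0$ such that, for all $k\ge k_0$, $0<\|u\|_{L^2(\Gamma)}<\infty$ and $$\|S_ku\|_{L^2(\Gamma)}\ge c\,k^{-2/3}\|u\|_{L^2(\Gamma)},\qquad \|\partial_{x_1}S_ku\|_{L^2(\Gamma)}\ge c\,k^{1/3}\|u\|_{L^2(\Gamma)},$$ in the same sense. Consequently the power $1/3$ in the bound $\|S_k\|_{L^2(\Gamma)\to H^1(\Gamma)}\lesssim k^{1/3}\log k$ for curved $\Gamma$ is optimal: if $s,C,k_0\in\mathbb R$ are such that $\|S_kv\|_{H^1(\Gamma)}\le C\,k^{s}\log k\,\|v\|_{L^2(\Gamma)}$ for all $k\ge k_0$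 and all $v\in L^2(\Gamma)$, then $s\ge 1/3$. -/

import Mathlib

open scoped ContDiff MeasureTheory

noncomputable section

namespace SingleLayer

/-- The Hankel function `H_ν^{(1)}(z)` of the first kind, for order `ν > -1/2` and argument `z > 0`,
given by Hankel's integral
`(2/(πz))^{1/2} e^{i(z - νπ/2 - π/4)} Γ(ν+1/2)⁻¹ ∫₀^∞ e^{-t} t^{ν-1/2} (1 + it/(2z))^{ν-1/2} dt`,
with the principal branch of the power. -/
def hankelH1 (ν z : ℝ) : ℂ :=
  ((Real.sqrt (2 / (Real.pi * z)) / Real.Gamma (ν + 1 / 2) : ℝ) : ℂ)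
    * Complex.exp (Complex.I * ((z - ν * Real.pi / 2 - Real.pi / 4 : ℝ) : ℂ))
    * ∫ t in Set.Ioi (0 : ℝ), ((Real.exp (-t) * t ^ (ν - 1 / 2) : ℝ) : ℂ)
        * (1 + Complex.I * ((t / (2 * z) : ℝ) : ℂ)) ^ ((ν - 1 / 2 : ℝ) : ℂ)

/-- The outgoing fundamental solution `Φ_k(x,y)` of the Helmholtz equation in `ℝ^d`:
`(i/4) (k/(2π|x-y|))^{(d-2)/2} H^{(1)}_{d/2-1}(k|x-y|)`. -/
def fundSol (d : ℕ) (k : ℝ) (x y : EuclideanSpace ℝ (Fin d)) : ℂ :=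
  Complex.I / 4
    * (((k / (2 * Real.pi * dist x y)) ^ (((d : ℝ) - 2) / 2) : ℝ) : ℂ)
    * hankelH1 ((d : ℝ) / 2 - 1) (k * dist x y)

/-- The coordinate map `x' ↦ (x', g(x'))` of the graph of `g`. -/
def graphMap {m : ℕ} (g : EuclideanSpace ℝ (Fin m) → ℝ) (x' : EuclideanSpace ℝ (Fin m)) :
    EuclideanSpace ℝ (Fin (m + 1)) :=
  WithLp.toLp 2 (Fin.snoc (α := fun _ => ℝ) (fun i => x' i) (g x'))

/-- The projection `(x', x_d) ↦ x'`. -/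
def tangentialPart {m : ℕ} (x : EuclideanSpace ℝ (Fin (m + 1))) : EuclideanSpace ℝ (Fin m) :=
  WithLp.toLp 2 (fun i => x i.castSucc)

/-- The hypersurface `{(x', g(x')) : |x'| < 1}`. -/
def graphSurface {m : ℕ} (g : EuclideanSpace ℝ (Fin m) → ℝ) :
    Set (EuclideanSpace ℝ (Fin (m + 1))) :=
  graphMap g '' Metric.ball 0 1

/-- The surface measure `ds` on `{(x', g(x')) : |x'| < 1}`: the (normalised) Hausdorff measure of
dimension `m` restricted to the hypersurface. -/
def surfaceMeasure {m : ℕ} (g : EuclideanSpace ℝ (Fin m) → ℝ) :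
    MeasureTheory.Measure (EuclideanSpace ℝ (Fin (m + 1))) :=
  (μHE[m]).restrict (graphSurface g)

/-- The single-layer operator `S_k φ(x) = ∫_Γ Φ_k(x,y) φ(y) ds(y)` on the graph of `g`. -/
def singleLayer {m : ℕ} (g : EuclideanSpace ℝ (Fin m) → ℝ) (k : ℝ)
    (φ : EuclideanSpace ℝ (Fin (m + 1)) → ℂ) (x : EuclideanSpace ℝ (Fin (m + 1))) : ℂ :=
  ∫ y, fundSol (m + 1) k x y * φ y ∂(surfaceMeasure g)

/-- `‖v‖_{L²(Γ)}`, `Γ` the graph of `g`. -/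
def l2Norm {m : ℕ} (g : EuclideanSpace ℝ (Fin m) → ℝ)
    (v : EuclideanSpace ℝ (Fin (m + 1)) → ℂ) : ENNReal :=
  MeasureTheory.eLpNorm v 2 (surfaceMeasure g)

/-- The classical partial derivative `∂_{x_i} v` on the graph of `g` in the coordinates `x'`, i.e. the
derivative of `x' ↦ v(x', g(x'))` in direction `e_i`, as a function on the hypersurface. (It has the
value `0` where this derivative does not exist.) -/
def coordDeriv {m : ℕ} (g : EuclideanSpace ℝ (Fin m) → ℝ) (i : Fin m)
    (v : EuclideanSpace ℝ (Fin (m + 1)) → ℂ) (x : EuclideanSpace ℝ (Fin (m + 1))) : ℂ :=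
  lineDeriv ℝ (fun x' => v (graphMap g x')) (tangentialPart x) (EuclideanSpace.single i 1)

/-- `w` is a weak partial derivative `∂_{x_i} v` on the graph of `g` in the coordinates `x'`,
`|x'| < 1`; both `v` and `w` are functions on the hypersurface. -/
def IsWeakCoordDeriv {m : ℕ} (g : EuclideanSpace ℝ (Fin m) → ℝ) (i : Fin m)
    (v w : EuclideanSpace ℝ (Fin (m + 1)) → ℂ) : Prop :=
  MeasureTheory.LocallyIntegrableOn (fun x' => v (graphMap g x')) (Metric.ball 0 1) ∧
  MeasureTheory.LocallyIntegrableOn (fun x' => w (graphMap g x')) (Metric.ball 0 1) ∧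
  ∀ φ : EuclideanSpace ℝ (Fin m) → ℝ, ContDiff ℝ ∞ φ → HasCompactSupport φ →
    tsupport φ ⊆ Metric.ball 0 1 →
    ∫ x', ((fderiv ℝ φ x' (EuclideanSpace.single i 1) : ℝ) : ℂ) * v (graphMap g x')
      = - ∫ x', ((φ x' : ℝ) : ℂ) * w (graphMap g x')

/-- `‖v‖_{H¹(Γ)} = (‖v‖²_{L²(Γ)} + ∑ᵢ ‖∂_{x_i} v‖²_{L²(Γ)})^{1/2}` with weak derivatives in the
coordinates `x'`, `Γ` the graph of `g`. Weak derivatives are unique up to null sets; the value is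
`∞` when `v ∉ H¹(Γ)`. -/
def h1Norm {m : ℕ} (g : EuclideanSpace ℝ (Fin m) → ℝ)
    (v : EuclideanSpace ℝ (Fin (m + 1)) → ℂ) : ENNReal :=
  ⨅ (w : Fin m → EuclideanSpace ℝ (Fin (m + 1)) → ℂ) (_ : ∀ i, IsWeakCoordDeriv g i v (w i)),
    (l2Norm g v ^ (2 : ℝ) + ∑ i, l2Norm g (w i) ^ (2 : ℝ)) ^ (1 / 2 : ℝ)

/-- The estimate `‖S_k u‖_{H¹(Γ)} ≤ C k^s log k ‖u‖_{L²(Γ)}` for all `u ∈ L²(Γ)` and `k ≥ k₀`. -/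
def L2H1Bound {m : ℕ} (g : EuclideanSpace ℝ (Fin m) → ℝ) (s C k₀ : ℝ) : Prop :=
  ∀ k : ℝ, k₀ ≤ k → ∀ u : EuclideanSpace ℝ (Fin (m + 1)) → ℂ,
    MeasureTheory.MemLp u 2 (surfaceMeasure g) →
    h1Norm g (singleLayer g k u) ≤ ENNReal.ofReal (C * k ^ s * Real.log k) * l2Norm g u

/-- The function `e^{ikx₁} χ(ε⁻¹ k^{γ₁} x₁) χ(ε⁻¹ k^{γ₂} |x''|)` on `ℝ^{n+2}`, where
`x = (x₁, x'', x_{n+2})`, `x'' ∈ ℝ^n`. -/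
def testFun (n : ℕ) (χ : ℝ → ℝ) (ε γ₁ γ₂ k : ℝ) (x : EuclideanSpace ℝ (Fin (n + 2))) : ℂ :=
  Complex.exp (Complex.I * ((k * x 0 : ℝ) : ℂ))
    * ((χ (x 0 * ε⁻¹ * k ^ γ₁)
        * χ (ε⁻¹ * k ^ γ₂ * Real.sqrt (∑ i : Fin n, x i.succ.castSucc ^ 2)) : ℝ) : ℂ)

/-- The flat piece: the graph of `0`. -/
def flatProfile (n : ℕ) : EuclideanSpace ℝ (Fin (n + 1)) → ℝ := fun _ => 0

/-- The curved piece: the graph of `|x'|²`. -/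
def paraboloidProfile (n : ℕ) : EuclideanSpace ℝ (Fin (n + 1)) → ℝ := fun x' => ‖x'‖ ^ 2

end SingleLayer

end

open SingleLayer

/-! Write $d=n+2$, $\rho_1=\epsilon k^{-\gamma_1}$ and $\rho_2=\epsilon k^{-\gamma_2}$. The source
is a plane wave $e^{iky_1}$ cut off to a box of length about $\rho_1$ and width about $\rho_2$. The
potential is observed on a region of the same shape, moved downstream to $x_1\approx 10\rho_1$. With
$r$ the distance between a target point and a source point of the graph, and $D=x_1-y_1$, one has
$(r-D)(r+D)=|x''-y''|^2+(g(x)-g(y))^2$. Hence $k(r-D)$ is small as soon as $k\rho_2^2\ll\rho_1$ and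
$k(g(x)-g(y))^2\lesssim\rho_1$ (`dist_graphMap_bounds`). Moreover $kr\gtrsim k\rho_1$ is large, so
Hankel's integral is near its limit. After multiplication by $e^{-ikx_1}$ and a constant phase the
integrand then has positive real part (`kernel_bounds`), so nothing cancels and $|S_ku|$ is
comparable to amplitude times source volume on the target (`beamSize_le_re`, `norm_singleLayer_le`).
Source and target have comparable volumes, so this product bounds $\|S_ku\|/\|u\|$ from below, up to
a constant.

The derivative is bounded below by duality, which treats classical and weak derivatives alike.
Pairing it with $e^{-ikx_1}\beta$, for a bump $\beta$ on the target, moves the derivative onto the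
test function. The term with $ik\beta$ contributes about $k$ times the size of $S_ku$; the term with
$\partial_{x_1}\beta$ is smaller by a factor $(k\rho_1)^{-1}$. Cauchy–Schwarz concludes
(`le_eLpNorm_of_waveTest`).

Under $1+\gamma_1=2\gamma_2$ amplitude times volume is a multiple of $k^{-\gamma_2}$ in every
dimension (`amplitude_mul_volume`), so longer beams give better bounds. On the flat piece the normal
condition is void and $\gamma_1=0$ is allowed. On the paraboloid $|g|\lesssim\rho_1^2$ along the
beam, so $k\rho_1^4\lesssim\rho_1$, which gives $\gamma_1=1/3$. Optimality follows because a
logarithm cannot make up for a missing power of $k$. -/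

namespace SingleLayer

open scoped ENNReal NNReal
open MeasureTheory Set

/-! ### Surface measure in graph coordinates -/

section Graph

variable {m : ℕ} {g : EuclideanSpace ℝ (Fin m) → ℝ}

@[simp] lemma graphMap_castSucc (x : EuclideanSpace ℝ (Fin m)) (i : Fin m) :
    graphMap g x i.castSucc = x i := by
  simp [graphMap]

@[simp] lemma graphMap_last (x : EuclideanSpace ℝ (Fin m)) :
    graphMap g x (Fin.last m) = g x := by
  simp [graphMap]

@[simp] lemma tangentialPart_graphMap (x : EuclideanSpace ℝ (Fin m)) :
    tangentialPart (graphMap g x) = x := by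
  ext i
  simp [tangentialPart]

lemma dist_graphMap_sq (x y : EuclideanSpace ℝ (Fin m)) :
    dist (graphMap g x) (graphMap g y) ^ 2 = dist x y ^ 2 + (g x - g y) ^ 2 := by
  rw [EuclideanSpace.dist_eq, EuclideanSpace.dist_eq, Real.sq_sqrt (by positivity),
    Real.sq_sqrt (by positivity), Fin.sum_univ_castSucc]
  simp [Real.dist_eq, sq_abs]

lemma dist_le_dist_graphMap (x y : EuclideanSpace ℝ (Fin m)) :
    dist x y ≤ dist (graphMap g x) (graphMap g y) := by
  refine le_of_sq_le_sq ?_ dist_nonneg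
  rw [dist_graphMap_sq]
  nlinarith [sq_nonneg (g x - g y)]

lemma continuous_graphMap (hg : Continuous g) : Continuous (graphMap g) := by
  unfold graphMap
  refine (PiLp.continuous_toLp 2 _).comp (continuous_pi fun i => ?_)
  refine Fin.lastCases ?_ (fun j => ?_) i
  · simpa using hg
  · simp only [Fin.snoc_castSucc]
    fun_prop

lemma antilipschitzWith_graphMap : AntilipschitzWith 1 (graphMap g) :=
  AntilipschitzWith.of_le_mul_dist fun x y => by simpa using dist_le_dist_graphMap x y

lemma measurableEmbedding_graphMap (hg : Continuous g) : MeasurableEmbedding (graphMap g) := by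
  refine Continuous.measurableEmbedding (continuous_graphMap hg) ?_
  exact antilipschitzWith_graphMap.injective

/-- The surface measure on the graph of `g`, in the coordinates `x'`. -/
noncomputable def graphMeasure (g : EuclideanSpace ℝ (Fin m) → ℝ) :
    Measure (EuclideanSpace ℝ (Fin m)) :=
  (surfaceMeasure g).comap (graphMap g)

lemma map_graphMeasure (hg : Continuous g) :
    (graphMeasure g).map (graphMap g) = surfaceMeasure g := by
  have h := measurableEmbedding_graphMap hg
  rw [graphMeasure, h.map_comap, surfaceMeasure, Measure.restrict_restrict h.measurableSet_range,
    graphSurface, inter_eq_self_of_subset_right (image_subset_range _ _)]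

lemma graphMeasure_apply (hg : Continuous g) {s : Set (EuclideanSpace ℝ (Fin m))}
    (hs : MeasurableSet s) :
    graphMeasure g s = μHE[m] (graphMap g '' (s ∩ Metric.ball 0 1)) := by
  have h := measurableEmbedding_graphMap hg
  rw [graphMeasure, h.comap_apply, surfaceMeasure,
    Measure.restrict_apply (h.measurableSet_image.2 hs), graphSurface, image_inter h.injective]

/-- The projection of the graph to its coordinates is 1-Lipschitz, so it does not increase Hausdorff
measure. Together with `graphMeasure_le` this comparability of the surface and Lebesgue measures is
all that is used, and no area formula is needed. -/
lemma volume_restrict_le_graphMeasure (hg : Continuous g) :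
    (volume : Measure (EuclideanSpace ℝ (Fin m))).restrict (Metric.ball 0 1) ≤ graphMeasure g := by
  refine Measure.le_iff.2 fun s hs => ?_
  rw [Measure.restrict_apply hs, graphMeasure_apply hg hs,
    ← EuclideanSpace.euclideanHausdorffMeasure_eq_volume, Measure.euclideanHausdorffMeasure_def,
    Measure.euclideanHausdorffMeasure_def, Measure.smul_apply, Measure.smul_apply]
  gcongr
  simpa using (antilipschitzWith_graphMap (g := g)).le_hausdorffMeasure_image
    (d := (m : ℝ)) (by positivity) (s ∩ Metric.ball 0 1)

lemma dist_graphMap_le {x y : EuclideanSpace ℝ (Fin m)} (h : |g x - g y| ≤ 2 * dist x y) :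
    dist (graphMap g x) (graphMap g y) ≤ 3 * dist x y := by
  refine le_of_sq_le_sq ?_ (by positivity)
  rw [dist_graphMap_sq]
  have := abs_le.1 h
  nlinarith [this.1, this.2, dist_nonneg (x := x) (y := y)]

/-- The chart is 3-Lipschitz on the unit ball, because $1+2^2\le 3^2$, and an $L$-Lipschitz map
increases $m$-dimensional Hausdorff measure by at most $L^m$. -/
lemma graphMeasure_le (hg : Continuous g)
    (hL : ∀ x ∈ Metric.ball 0 1, ∀ y ∈ Metric.ball 0 1, |g x - g y| ≤ 2 * dist x y) :
    graphMeasure g ≤ ((3 : ℝ≥0∞) ^ m) • (volume : Measure (EuclideanSpace ℝ (Fin m))) := by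
  refine Measure.le_iff.2 fun s hs => ?_
  rw [Measure.smul_apply, graphMeasure_apply hg hs,
    ← EuclideanSpace.euclideanHausdorffMeasure_eq_volume, Measure.euclideanHausdorffMeasure_def,
    Measure.euclideanHausdorffMeasure_def, Measure.smul_apply, Measure.smul_apply, smul_comm]
  gcongr
  have h3 : LipschitzOnWith 3 (graphMap g) (s ∩ Metric.ball 0 1) :=
    LipschitzOnWith.of_dist_le_mul fun x hx y hy => by
      simpa using dist_graphMap_le (hL x hx.2 y hy.2)
  refine (h3.hausdorffMeasure_image_le (d := (m : ℝ)) (by positivity)).trans ?_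
  simp only [ENNReal.rpow_natCast, smul_eq_mul]
  gcongr
  · simp
  · exact inter_subset_left

lemma graphMeasure_compl_ball (hg : Continuous g) : graphMeasure g (Metric.ball 0 1)ᶜ = 0 := by
  rw [graphMeasure_apply hg Metric.isOpen_ball.measurableSet.compl]
  simp

lemma graphMeasure_univ_lt_top (hg : Continuous g)
    (hL : ∀ x ∈ Metric.ball 0 1, ∀ y ∈ Metric.ball 0 1, |g x - g y| ≤ 2 * dist x y) :
    graphMeasure g univ < ⊤ := by
  have h1 : graphMeasure g univ ≤ graphMeasure g (Metric.ball 0 1) := by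
    rw [← union_compl_self (Metric.ball (0 : EuclideanSpace ℝ (Fin m)) 1)]
    exact (measure_union_le _ _).trans (by rw [graphMeasure_compl_ball hg, add_zero])
  refine h1.trans_lt ((graphMeasure_le hg hL _).trans_lt ?_)
  rw [Measure.smul_apply, smul_eq_mul]
  exact ENNReal.mul_lt_top (by finiteness) Metric.isBounded_ball.measure_lt_top

lemma l2Norm_eq (hg : Continuous g) (v : EuclideanSpace ℝ (Fin (m + 1)) → ℂ) :
    l2Norm g v = eLpNorm (fun x => v (graphMap g x)) 2 (graphMeasure g) := by
  rw [l2Norm, ← map_graphMeasure hg, (measurableEmbedding_graphMap hg).eLpNorm_map_measure]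
  rfl

lemma singleLayer_graphMap (hg : Continuous g) (k : ℝ)
    (φ : EuclideanSpace ℝ (Fin (m + 1)) → ℂ) (x : EuclideanSpace ℝ (Fin (m + 1))) :
    singleLayer g k φ x
      = ∫ y, fundSol (m + 1) k x (graphMap g y) * φ (graphMap g y) ∂(graphMeasure g) := by
  rw [singleLayer, ← map_graphMeasure hg, (measurableEmbedding_graphMap hg).integral_map]

end Graph

/-! ### Hankel's integral and the radial fundamental solution -/

section Hankel

open Filter Topology

/-- The integrand of Hankel's integral with exponent `a = ν - 1/2`. -/
noncomputable def hankelIntegrand (a z t : ℝ) : ℂ :=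
  ((Real.exp (-t) * t ^ a : ℝ) : ℂ) * (1 + Complex.I * ((t / (2 * z) : ℝ) : ℂ)) ^ (a : ℂ)

/-- Hankel's integral with exponent `a = ν - 1/2`. -/
noncomputable def hankelIntegral (a z : ℝ) : ℂ :=
  ∫ t in Ioi (0 : ℝ), hankelIntegrand a z t

lemma measurable_hankelIntegrand (a : ℝ) :
    Measurable fun p : ℝ × ℝ => hankelIntegrand a p.1 p.2 := by
  unfold hankelIntegrand
  fun_prop

lemma measurable_hankelIntegral (a : ℝ) : Measurable (hankelIntegral a) :=
  ((measurable_hankelIntegrand a).stronglyMeasurable.integral_prod_right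
    (ν := volume.restrict (Ioi (0 : ℝ)))).measurable

lemma one_add_I_mul_mem_slitPlane (s : ℝ) : 1 + Complex.I * (s : ℂ) ∈ Complex.slitPlane := by
  left
  simp

lemma one_le_norm_one_add_I_mul (s : ℝ) : 1 ≤ ‖1 + Complex.I * (s : ℂ)‖ := by
  simpa using Complex.abs_re_le_norm (1 + Complex.I * (s : ℂ))

lemma norm_one_add_I_mul_le (s : ℝ) : ‖1 + Complex.I * (s : ℂ)‖ ≤ 1 + |s| := by
  refine (norm_add_le _ _).trans ?_
  simp

/-- An integrable majorant of Hankel's integrand, valid for `z ≥ 1`. -/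
noncomputable def hankelMajorant (a t : ℝ) : ℝ :=
  (⌈|a|⌉₊.factorial * Real.exp 1) * (Real.exp (-(1 / 2 * t)) * t ^ a)

lemma integrableOn_hankelMajorant {a : ℝ} (ha : -1 < a) :
    IntegrableOn (hankelMajorant a) (Ioi 0) := by
  refine Integrable.const_mul ?_ _
  have h := integrableOn_rpow_mul_exp_neg_mul_rpow (p := 1) (b := 1 / 2) ha one_pos (by norm_num)
  refine h.congr_fun (fun t _ => ?_) measurableSet_Ioi
  simp only [Real.rpow_one]
  rw [mul_comm]
  ring_nf

/-- The base has modulus at least 1, so the exponent may be raised to the integer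
$N=\lceil|a|\rceil$, and then $x^N\le N!\,e^x$. The resulting $e^{t/2}$ uses up only half of the
decay $e^{-t}$ in Hankel's integrand. -/
lemma norm_one_add_I_mul_rpow_le (a : ℝ) {s t : ℝ} (ht : 0 ≤ t) (hs : |s| ≤ 1 / 2 * t) :
    ‖1 + Complex.I * (s : ℂ)‖ ^ a ≤ ⌈|a|⌉₊.factorial * Real.exp 1 * Real.exp (1 / 2 * t) := by
  have h1 := one_le_norm_one_add_I_mul s
  have h2 := norm_one_add_I_mul_le s
  calc ‖1 + Complex.I * (s : ℂ)‖ ^ a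
      ≤ ‖1 + Complex.I * (s : ℂ)‖ ^ (⌈|a|⌉₊ : ℝ) :=
        Real.rpow_le_rpow_of_exponent_le h1 ((le_abs_self a).trans (Nat.le_ceil _))
    _ = ‖1 + Complex.I * (s : ℂ)‖ ^ ⌈|a|⌉₊ := Real.rpow_natCast _ _
    _ ≤ (1 + 1 / 2 * t) ^ ⌈|a|⌉₊ := by gcongr; linarith
    _ ≤ ⌈|a|⌉₊.factorial * Real.exp (1 + 1 / 2 * t) := by
        have := Real.pow_div_factorial_le_exp (1 + 1 / 2 * t) (by positivity) ⌈|a|⌉₊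
        rw [div_le_iff₀ (by positivity)] at this
        linarith
    _ = _ := by rw [Real.exp_add]; ring

lemma norm_hankelIntegrand_le (a : ℝ) {z t : ℝ} (hz : 1 ≤ z) (ht : 0 ≤ t) :
    ‖hankelIntegrand a z t‖ ≤ hankelMajorant a t := by
  have hs : |t / (2 * z)| ≤ 1 / 2 * t := by
    rw [abs_of_nonneg (by positivity), div_le_iff₀ (by positivity)]
    nlinarith
  have h := norm_one_add_I_mul_rpow_le a ht hs
  rw [hankelIntegrand, norm_mul, Complex.norm_cpow_real, Complex.norm_real,
    Real.norm_of_nonneg (by positivity), hankelMajorant]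
  have h3 : Real.exp (-t) * Real.exp (1 / 2 * t) = Real.exp (-(1 / 2 * t)) := by
    rw [← Real.exp_add]; ring_nf
  calc _ ≤ Real.exp (-t) * t ^ a * (⌈|a|⌉₊.factorial * Real.exp 1 * Real.exp (1 / 2 * t)) := by
        gcongr
    _ = _ := by rw [← h3]; ring

lemma measurable_hankelIntegrand_right (a z : ℝ) : Measurable (hankelIntegrand a z) :=
  (measurable_hankelIntegrand a).comp measurable_prodMk_left

lemma norm_hankelIntegral_le {a z : ℝ} (ha : -1 < a) (hz : 1 ≤ z) :
    ‖hankelIntegral a z‖ ≤ ∫ t in Ioi 0, hankelMajorant a t :=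
  norm_integral_le_of_norm_le (integrableOn_hankelMajorant ha)
    ((ae_restrict_iff' measurableSet_Ioi).2
      (ae_of_all _ fun _ ht => norm_hankelIntegrand_le a hz (le_of_lt ht)))

/-- Dominated convergence: the complex power tends to 1 and Euler's integral for $\Gamma$ remains.
This is the only asymptotic information about the Hankel function that the proof uses. -/
lemma tendsto_hankelIntegral {a : ℝ} (ha : -1 < a) :
    Tendsto (hankelIntegral a) atTop (𝓝 (Real.Gamma (a + 1) : ℂ)) := by
  have h : ∫ t in Ioi (0 : ℝ), ((Real.exp (-t) * t ^ a : ℝ) : ℂ) = (Real.Gamma (a + 1) : ℂ) := by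
    rw [integral_complex_ofReal, Real.Gamma_eq_integral (by linarith)]
    simp
  rw [← h]
  refine tendsto_integral_filter_of_dominated_convergence (hankelMajorant a) ?_ ?_
    (integrableOn_hankelMajorant ha) ?_
  · exact Eventually.of_forall fun z =>
      (measurable_hankelIntegrand_right a z).aestronglyMeasurable
  · filter_upwards [eventually_ge_atTop 1] with z hz
    exact (ae_restrict_iff' measurableSet_Ioi).2
      (ae_of_all _ fun _ ht => norm_hankelIntegrand_le a hz (le_of_lt ht))
  · refine ae_of_all _ fun t => ?_
    have h1 : Tendsto (fun z : ℝ => t / (2 * z)) atTop (𝓝 0) :=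
      Tendsto.div_atTop tendsto_const_nhds (tendsto_id.const_mul_atTop (by norm_num))
    have h2 : Tendsto (fun z : ℝ => 1 + Complex.I * ((t / (2 * z) : ℝ) : ℂ)) atTop (𝓝 1) := by
      have := ((Complex.continuous_ofReal.tendsto 0).comp h1).const_mul Complex.I |>.const_add 1
      simpa using this
    have h3 : Tendsto (fun z : ℝ => (1 + Complex.I * ((t / (2 * z) : ℝ) : ℂ)) ^ (a : ℂ)) atTop
        (𝓝 1) := by
      have := h2.cpow (tendsto_const_nhds (x := (a : ℂ))) Complex.one_mem_slitPlane
      simpa using this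
    simpa [hankelIntegrand] using h3.const_mul ((Real.exp (-t) * t ^ a : ℝ) : ℂ)

lemma hasDerivAt_hankelIntegrand (a t : ℝ) {z : ℝ} (hz : 1 ≤ z) :
    HasDerivAt (fun z => hankelIntegrand a z t)
      (((Real.exp (-t) * t ^ a : ℝ) : ℂ) * ((a : ℂ)
        * (1 + Complex.I * ((t / (2 * z) : ℝ) : ℂ)) ^ ((a : ℂ) - 1)
        * (Complex.I * ((-(t / (2 * z ^ 2)) : ℝ) : ℂ)))) z := by
  have h1 : HasDerivAt (fun z : ℝ => t / (2 * z)) (-(t / (2 * z ^ 2))) z := by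
    have := ((hasDerivAt_id z).const_mul 2).inv (by simp; linarith) |>.const_mul t
    simp only [id] at this
    refine (this.congr_deriv ?_).congr_of_eventuallyEq ?_
    · field_simp
    · exact Eventually.of_forall fun y => by simp [div_eq_mul_inv]
  have h2 : HasDerivAt (fun z : ℝ => 1 + Complex.I * ((t / (2 * z) : ℝ) : ℂ))
      (Complex.I * ((-(t / (2 * z ^ 2)) : ℝ) : ℂ)) z :=
    (h1.ofReal_comp.const_mul Complex.I).const_add 1
  have h3 := (Complex.hasStrictDerivAt_cpow_const (c := (a : ℂ))
    (one_add_I_mul_mem_slitPlane (t / (2 * z)))).hasDerivAt.comp z h2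
  exact h3.const_mul _

/-- With $w=1+it/(2z)$, the inner derivative has modulus $t/(2z^2)\le
t/(2z)=\operatorname{Im}w\le|w|$. It makes up for the power lost in $w^{a-1}$, so the majorant of
the integrand serves again. -/
lemma norm_deriv_hankelIntegrand_le (a : ℝ) {z t : ℝ} (hz : 1 ≤ z) (ht : 0 ≤ t) :
    ‖((Real.exp (-t) * t ^ a : ℝ) : ℂ) * ((a : ℂ)
        * (1 + Complex.I * ((t / (2 * z) : ℝ) : ℂ)) ^ ((a : ℂ) - 1)
        * (Complex.I * ((-(t / (2 * z ^ 2)) : ℝ) : ℂ)))‖ ≤ |a| * hankelMajorant a t := by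
  have h1 := one_le_norm_one_add_I_mul (t / (2 * z))
  have h2 := norm_hankelIntegrand_le a hz ht
  have h0 : (1 + Complex.I * ((t / (2 * z) : ℝ) : ℂ)) ≠ 0 :=
    Complex.slitPlane_ne_zero (one_add_I_mul_mem_slitPlane _)
  have h4 : ‖Complex.I * ((-(t / (2 * z ^ 2)) : ℝ) : ℂ)‖
      ≤ ‖1 + Complex.I * ((t / (2 * z) : ℝ) : ℂ)‖ := by
    have h5 := Complex.abs_im_le_norm (1 + Complex.I * ((t / (2 * z) : ℝ) : ℂ))
    refine le_trans ?_ h5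
    rw [norm_mul, Complex.norm_I, one_mul, Complex.norm_real]
    have : (1 + Complex.I * ((t / (2 * z) : ℝ) : ℂ)).im = t / (2 * z) := by
      simp [-Complex.ofReal_div, -Complex.ofReal_mul]
    rw [this, norm_neg, Real.norm_eq_abs, abs_of_nonneg (by positivity),
      abs_of_nonneg (by positivity)]
    gcongr
    nlinarith
  rw [hankelIntegrand, norm_mul] at h2
  rw [Complex.cpow_sub _ _ h0, Complex.cpow_one]
  simp only [norm_mul, norm_div] at h4 h2 ⊢
  have h6 : ‖(a : ℂ)‖ = |a| := by simp
  rw [h6]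
  set w := ‖1 + Complex.I * ((t / (2 * z) : ℝ) : ℂ)‖ with hw
  have hw0 : 0 < w := by linarith
  calc _ ≤ ‖((Real.exp (-t) : ℝ) : ℂ)‖ * ‖((t ^ a : ℝ) : ℂ)‖ * (|a| *
        (‖(1 + Complex.I * ((t / (2 * z) : ℝ) : ℂ)) ^ (a : ℂ)‖ / w) * w) := by
        rw [Complex.ofReal_mul, norm_mul]
        gcongr
    _ = |a| * (‖((Real.exp (-t) * t ^ a : ℝ) : ℂ)‖
        * ‖(1 + Complex.I * ((t / (2 * z) : ℝ) : ℂ)) ^ (a : ℂ)‖) := by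
        rw [Complex.ofReal_mul, norm_mul]
        field_simp
    _ ≤ _ := by gcongr

lemma hasDerivAt_hankelIntegral {a : ℝ} (ha : -1 < a) :
    ∃ C, ∀ z, 1 < z → ∃ D, HasDerivAt (hankelIntegral a) D z ∧ ‖D‖ ≤ C := by
  refine ⟨∫ t in Ioi 0, |a| * hankelMajorant a t, fun z hz =>
    ⟨∫ t in Ioi (0 : ℝ), ((Real.exp (-t) * t ^ a : ℝ) : ℂ) * ((a : ℂ)
        * (1 + Complex.I * ((t / (2 * z) : ℝ) : ℂ)) ^ ((a : ℂ) - 1)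
        * (Complex.I * ((-(t / (2 * z ^ 2)) : ℝ) : ℂ))), ?_, ?_⟩⟩
  · refine (hasDerivAt_integral_of_dominated_loc_of_deriv_le (s := Ioi 1) (Ioi_mem_nhds hz)
      (F := fun z t => hankelIntegrand a z t)
      (F' := fun z t => ((Real.exp (-t) * t ^ a : ℝ) : ℂ) * ((a : ℂ)
        * (1 + Complex.I * ((t / (2 * z) : ℝ) : ℂ)) ^ ((a : ℂ) - 1)
        * (Complex.I * ((-(t / (2 * z ^ 2)) : ℝ) : ℂ))))
      (bound := fun t => |a| * hankelMajorant a t) ?_ ?_ ?_ ?_ ?_ ?_).2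
    · exact Eventually.of_forall fun z =>
        (measurable_hankelIntegrand_right a z).aestronglyMeasurable
    · refine (integrableOn_hankelMajorant ha).mono'
        (measurable_hankelIntegrand_right a z).aestronglyMeasurable
        ((ae_restrict_iff' measurableSet_Ioi).2
          (ae_of_all _ fun _ ht => norm_hankelIntegrand_le a hz.le (le_of_lt ht)))
    · apply Measurable.aestronglyMeasurable
      fun_prop
    · exact (ae_restrict_iff' measurableSet_Ioi).2 (ae_of_all _ fun t ht y hy =>
        norm_deriv_hankelIntegrand_le a (le_of_lt hy) (le_of_lt ht))
    · exact (integrableOn_hankelMajorant ha).const_mul _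
    · exact ae_of_all _ fun t y hy => hasDerivAt_hankelIntegrand a t (le_of_lt hy)
  · exact norm_integral_le_of_norm_le ((integrableOn_hankelMajorant ha).const_mul _)
      ((ae_restrict_iff' measurableSet_Ioi).2
        (ae_of_all _ fun _ ht => norm_deriv_hankelIntegrand_le a hz.le (le_of_lt ht)))

/-- Hankel's integral, normalised to tend to `1` at infinity. -/
noncomputable def normalizedHankel (n : ℕ) (z : ℝ) : ℂ :=
  hankelIntegral ((n : ℝ) / 2 - 1 / 2) z / (Real.Gamma ((n : ℝ) / 2 + 1 / 2) : ℂ)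

/-- The modulus of the leading term of the fundamental solution in `ℝ^{n+2}`. -/
noncomputable def amplitude (n : ℕ) (k r : ℝ) : ℝ :=
  1 / 4 * (k / (2 * Real.pi * r)) ^ ((n : ℝ) / 2) * Real.sqrt (2 / (Real.pi * (k * r)))

/-- The constant phase factor of the fundamental solution in `ℝ^{n+2}`. -/
noncomputable def phaseConst (n : ℕ) : ℂ :=
  Complex.I * Complex.exp (Complex.I * ((-((n : ℝ) / 2 * Real.pi / 2) - Real.pi / 4 : ℝ) : ℂ))

/-- The radial profile of the fundamental solution in `ℝ^{n+2}`. -/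
noncomputable def radialSol (n : ℕ) (k r : ℝ) : ℂ :=
  phaseConst n * (amplitude n k r : ℂ) * Complex.exp (Complex.I * ((k * r : ℝ) : ℂ))
    * normalizedHankel n (k * r)

lemma norm_phaseConst (n : ℕ) : ‖phaseConst n‖ = 1 := by
  rw [phaseConst, norm_mul, mul_comm Complex.I, Complex.norm_exp_ofReal_mul_I]
  simp

lemma fundSol_eq_radialSol (n : ℕ) (k : ℝ) (x y : EuclideanSpace ℝ (Fin (n + 2))) :
    fundSol (n + 2) k x y = radialSol n k (dist x y) := by
  have h1 : ((n + 2 : ℕ) : ℝ) / 2 - 1 = n / 2 := by push_cast; ring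
  have h2 : (((n + 2 : ℕ) : ℝ) - 2) / 2 = n / 2 := by push_cast; ring
  rw [fundSol, h1, h2, hankelH1, radialSol, phaseConst, amplitude, normalizedHankel,
    hankelIntegral]
  have h3 : Complex.exp (Complex.I * ((k * dist x y - (n : ℝ) / 2 * Real.pi / 2 - Real.pi / 4 : ℝ)
      : ℂ)) = Complex.exp (Complex.I * ((-((n : ℝ) / 2 * Real.pi / 2) - Real.pi / 4 : ℝ) : ℂ))
        * Complex.exp (Complex.I * ((k * dist x y : ℝ) : ℂ)) := by
    rw [← Complex.exp_add]
    congr 1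
    push_cast
    ring
  rw [h3]
  simp only [hankelIntegrand]
  simp only [Complex.ofReal_mul, Complex.ofReal_div, Complex.ofReal_one, Complex.ofReal_ofNat]
  ring

lemma measurable_radialSol (n : ℕ) (k : ℝ) : Measurable (radialSol n k) := by
  have h := measurable_hankelIntegral ((n : ℝ) / 2 - 1 / 2)
  unfold radialSol amplitude normalizedHankel
  fun_prop

lemma neg_one_lt_half_sub (n : ℕ) : -1 < (n : ℝ) / 2 - 1 / 2 := by
  have : (0 : ℝ) ≤ n := n.cast_nonneg
  linarith

lemma exists_normalizedHankel_near_one (n : ℕ) :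
    ∃ Z, ∀ z ≥ Z, ‖normalizedHankel n z - 1‖ ≤ 1 / 4 := by
  have h := (tendsto_hankelIntegral (neg_one_lt_half_sub n)).div_const
    (Real.Gamma ((n : ℝ) / 2 + 1 / 2) : ℂ)
  have hG : Real.Gamma ((n : ℝ) / 2 + 1 / 2) ≠ 0 := (Real.Gamma_pos_of_pos (by positivity)).ne'
  rw [show (n : ℝ) / 2 - 1 / 2 + 1 = n / 2 + 1 / 2 by ring,
    div_self (Complex.ofReal_ne_zero.2 hG)] at h
  obtain ⟨Z, hZ⟩ := eventually_atTop.1 (Metric.tendsto_nhds.1 h (1 / 4) (by norm_num))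
  refine ⟨Z, fun z hz => ?_⟩
  have := hZ z hz
  rw [dist_eq_norm] at this
  exact this.le

lemma amplitude_pos (n : ℕ) {k r : ℝ} (hk : 0 < k) (hr : 0 < r) : 0 < amplitude n k r := by
  unfold amplitude
  positivity

lemma amplitude_anti (n : ℕ) {k r r' : ℝ} (hk : 0 < k) (hr : 0 < r) (h : r ≤ r') :
    amplitude n k r' ≤ amplitude n k r := by
  have hr' : 0 < r' := hr.trans_le h
  unfold amplitude
  gcongr

/-- The amplitude is homogeneous of degree $-(n+1)/2$ in $r$. With monotonicity this makes it
comparable to its value at $14\rho_1$ for all distances in $[7\rho_1,14\rho_1]$. -/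
lemma amplitude_half (n : ℕ) {k r : ℝ} (hk : 0 < k) (hr : 0 < r) :
    amplitude n k (r / 2) = 2 ^ (((n : ℝ) + 1) / 2) * amplitude n k r := by
  unfold amplitude
  have h1 : k / (2 * Real.pi * (r / 2)) = 2 * (k / (2 * Real.pi * r)) := by field_simp
  have h2 : 2 / (Real.pi * (k * (r / 2))) = 2 * (2 / (Real.pi * (k * r))) := by field_simp
  rw [h1, h2, Real.mul_rpow (by norm_num) (by positivity), Real.sqrt_mul (by norm_num),
    Real.sqrt_eq_rpow, add_div, Real.rpow_add (by norm_num)]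
  ring

/-- The bound may depend on $k$ in any way: it only justifies differentiation under the layer
integral at fixed $k$. The elementary factor is $C^1$ on $r>0$, so compactness bounds it together
with its derivative; Hankel's integral has its own bounds. -/
lemma exists_norm_deriv_radialSol_le (n : ℕ) {k r₀ : ℝ} (r₁ : ℝ) (hk : 0 < k) (hr₀ : 0 < r₀)
    (h : 1 < k * r₀) :
    ∃ C, ∀ r ∈ Icc r₀ r₁, DifferentiableAt ℝ (radialSol n k) r ∧ ‖deriv (radialSol n k) r‖ ≤ C := by
  set G : ℝ → ℂ := fun r => phaseConst n * (amplitude n k r : ℂ)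
    * Complex.exp (Complex.I * ((k * r : ℝ) : ℂ)) * (Real.Gamma ((n : ℝ) / 2 + 1 / 2) : ℂ)⁻¹ with hG
  have hGd : ContDiffOn ℝ 1 G (Ioi 0) := by
    have h1 : ContDiffOn ℝ 1 (fun r => amplitude n k r) (Ioi 0) := by
      unfold amplitude
      intro r hr
      have hr' : (0 : ℝ) < r := hr
      refine ContDiffAt.contDiffWithinAt ?_
      refine ContDiffAt.mul (ContDiffAt.mul contDiffAt_const ?_) ?_
      · refine ContDiffAt.rpow_const_of_ne ?_ (by positivity)
        exact contDiffAt_const.div (by fun_prop) (by positivity)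
      · refine ContDiffAt.sqrt ?_ (by positivity)
        exact contDiffAt_const.div (by fun_prop) (by positivity)
    have h2 : ContDiffOn ℝ 1 (fun r => (amplitude n k r : ℂ)) (Ioi 0) :=
      Complex.ofRealCLM.contDiff.comp_contDiffOn h1
    have h3 : ContDiff ℝ 1 (fun r : ℝ => Complex.exp (Complex.I * ((k * r : ℝ) : ℂ))) := by
      refine ContDiff.cexp (contDiff_const.mul ?_)
      exact Complex.ofRealCLM.contDiff.comp (contDiff_const.mul contDiff_id)
    exact ((contDiffOn_const.mul h2).mul h3.contDiffOn).mul contDiffOn_const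
  have hsub : Icc r₀ r₁ ⊆ Ioi 0 := fun r hr => hr₀.trans_le hr.1
  obtain ⟨C₁, hC₁⟩ := isCompact_Icc.exists_bound_of_continuousOn (hGd.continuousOn.mono hsub)
  obtain ⟨C₂, hC₂⟩ := isCompact_Icc.exists_bound_of_continuousOn
    ((hGd.continuousOn_deriv_of_isOpen isOpen_Ioi le_rfl).mono hsub)
  obtain ⟨C₃, hC₃⟩ := hasDerivAt_hankelIntegral (neg_one_lt_half_sub n)
  set C₄ := ∫ t in Ioi 0, hankelMajorant ((n : ℝ) / 2 - 1 / 2) t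
  refine ⟨C₂ * C₄ + C₁ * (C₃ * k), fun r hr => ?_⟩
  have hr0 : 0 < r := hsub hr
  have hkr : 1 < k * r := h.trans_le (by gcongr; exact hr.1)
  obtain ⟨D, hD, hDC⟩ := hC₃ (k * r) hkr
  have h1 : HasDerivAt G (deriv G r) r :=
    ((hGd.contDiffAt (Ioi_mem_nhds hr0)).differentiableAt (by norm_num)).hasDerivAt
  have h2 : HasDerivAt (fun r => hankelIntegral ((n : ℝ) / 2 - 1 / 2) (k * r)) (k • D) r := by
    have := hD.scomp r ((hasDerivAt_id r).const_mul k)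
    simpa [Function.comp_def] using this
  have h3 := h1.mul h2
  have h4 : radialSol n k = fun r => G r * hankelIntegral ((n : ℝ) / 2 - 1 / 2) (k * r) := by
    ext r
    simp only [radialSol, hG, normalizedHankel]
    ring
  rw [h4]
  refine ⟨h3.differentiableAt, ?_⟩
  have h5 : deriv (fun r => G r * hankelIntegral ((n : ℝ) / 2 - 1 / 2) (k * r)) r = _ := h3.deriv
  rw [h5]
  refine (norm_add_le _ _).trans ?_
  rw [norm_mul, norm_mul, norm_smul, Real.norm_of_nonneg hk.le]
  have hb := norm_hankelIntegral_le (neg_one_lt_half_sub n) hkr.le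
  have hb1 := hC₁ r hr
  have hb2 := hC₂ r hr
  have := (norm_nonneg _).trans hb1
  have := (norm_nonneg _).trans hb2
  rw [mul_comm C₃ k]
  gcongr

end Hankel

/-! ### Anisotropic rescaling to unit size -/

section Rescale

variable {n : ℕ}

/-- The diagonal map `(x₁, x'') ↦ (a x₁, b x'')`. -/
noncomputable def rescale (n : ℕ) (a b : ℝ) :
    EuclideanSpace ℝ (Fin (n + 1)) →ₗ[ℝ] EuclideanSpace ℝ (Fin (n + 1)) :=
  Matrix.toLpLin 2 2 (Matrix.diagonal (Fin.cons a fun _ => b : Fin (n + 1) → ℝ))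

@[simp] lemma rescale_zero (a b : ℝ) (x : EuclideanSpace ℝ (Fin (n + 1))) :
    rescale n a b x 0 = a * x 0 := by
  simp [rescale, Matrix.toLpLin_apply, Matrix.mulVec_diagonal]

@[simp] lemma rescale_succ (a b : ℝ) (x : EuclideanSpace ℝ (Fin (n + 1))) (i : Fin n) :
    rescale n a b x i.succ = b * x i.succ := by
  simp [rescale, Matrix.toLpLin_apply, Matrix.mulVec_diagonal]

lemma continuous_rescale (a b : ℝ) : Continuous (rescale n a b) :=
  LinearMap.continuous_of_finiteDimensional _

lemma det_rescale (a b : ℝ) : LinearMap.det (rescale n a b) = a * b ^ n := by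
  rw [rescale, Matrix.toLpLin_eq_toLin, LinearMap.det_toLin, Matrix.det_diagonal,
    Fin.prod_univ_succ]
  simp

lemma map_rescale_volume {a b : ℝ} (ha : 0 < a) (hb : 0 < b) :
    (volume : Measure (EuclideanSpace ℝ (Fin (n + 1)))).map (rescale n a⁻¹ b⁻¹)
      = ENNReal.ofReal (a * b ^ n) • volume := by
  have h : LinearMap.det (rescale n a⁻¹ b⁻¹) = (a * b ^ n)⁻¹ := by
    rw [det_rescale, mul_inv, inv_pow]
  rw [Measure.map_linearMap_addHaar_eq_smul_addHaar, h, inv_inv, abs_of_pos (by positivity)]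
  rw [h]
  positivity

lemma volume_rescale_preimage {a b : ℝ} (ha : 0 < a) (hb : 0 < b)
    {s : Set (EuclideanSpace ℝ (Fin (n + 1)))} (hs : MeasurableSet s) :
    volume (rescale n a⁻¹ b⁻¹ ⁻¹' s) = ENNReal.ofReal (a * b ^ n) * volume s := by
  rw [← Measure.map_apply (continuous_rescale _ _).measurable hs, map_rescale_volume ha hb]
  rfl

lemma integral_rescale {F : Type*} [NormedAddCommGroup F] [NormedSpace ℝ F] {a b : ℝ}
    (ha : 0 < a) (hb : 0 < b) {φ : EuclideanSpace ℝ (Fin (n + 1)) → F}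
    (hφ : Continuous φ) :
    ∫ x, φ (rescale n a⁻¹ b⁻¹ x) = (a * b ^ n) • ∫ x, φ x := by
  rw [← integral_map (continuous_rescale _ _).aemeasurable hφ.aestronglyMeasurable,
    map_rescale_volume ha hb, integral_smul_measure, ENNReal.toReal_ofReal (by positivity)]

lemma norm_sq_eq_zero_add_succ (x : EuclideanSpace ℝ (Fin (n + 1))) :
    ‖x‖ ^ 2 = x 0 ^ 2 + ∑ i : Fin n, x i.succ ^ 2 := by
  rw [EuclideanSpace.norm_sq_eq, Fin.sum_univ_succ]
  simp

lemma norm_rescale_le {a b : ℝ} (hb : 0 ≤ b) (hab : b ≤ a) (x : EuclideanSpace ℝ (Fin (n + 1))) :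
    ‖rescale n a b x‖ ≤ a * ‖x‖ := by
  have ha := hb.trans hab
  refine le_of_sq_le_sq ?_ (by positivity)
  rw [mul_pow, norm_sq_eq_zero_add_succ, norm_sq_eq_zero_add_succ]
  simp only [rescale_zero, rescale_succ, mul_pow, ← Finset.mul_sum]
  have h0 : 0 ≤ ∑ i : Fin n, x i.succ ^ 2 := by positivity
  have h1 : b ^ 2 ≤ a ^ 2 := by gcongr
  nlinarith

lemma rescale_rescale_inv {a b : ℝ} (ha : a ≠ 0) (hb : b ≠ 0)
    (x : EuclideanSpace ℝ (Fin (n + 1))) : rescale n a b (rescale n a⁻¹ b⁻¹ x) = x := by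
  ext i
  refine Fin.cases ?_ (fun j => ?_) i
  · simp [ha]
  · simp [hb]

end Rescale

/-! ### Geometry and phase along the beam -/

section Pointwise

variable {n : ℕ}

/-- Conditions on the profile `g`, the wave number `k` and the widths `ρ₁`, `ρ₂` of a beam in the
direction `x₁` under which the phase `k|x - y|` is close to `k(x₁ - y₁)` along the beam. -/
structure BeamScales (g : EuclideanSpace ℝ (Fin (n + 1)) → ℝ) (k ρ₁ ρ₂ : ℝ) : Prop where
  differentiable : Differentiable ℝ g
  lipschitz : ∀ x ∈ Metric.ball 0 1, ∀ y ∈ Metric.ball 0 1, |g x - g y| ≤ 2 * dist x y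
  k_pos : 0 < k
  width_pos : 0 < ρ₂
  width_le : ρ₂ ≤ ρ₁
  length_lt : 12 * ρ₁ < 1
  one_le : 1 ≤ k * ρ₁
  transverse : k * ρ₂ ^ 2 ≤ ρ₁ / 100
  normal : ∀ x y, ‖x‖ ≤ 12 * ρ₁ → ‖y‖ ≤ 12 * ρ₁ → k * (g x - g y) ^ 2 ≤ ρ₁ / 4

/-- The region of observation, downstream of the source. -/
def beamTarget (n : ℕ) (ρ₁ ρ₂ : ℝ) : Set (EuclideanSpace ℝ (Fin (n + 1))) :=
  rescale n ρ₁⁻¹ ρ₂⁻¹ ⁻¹' Metric.ball (EuclideanSpace.single 0 10) 1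

/-- A box containing the support of the source. -/
def beamSource (n : ℕ) (ρ₁ ρ₂ : ℝ) : Set (EuclideanSpace ℝ (Fin (n + 1))) :=
  {y | |y 0| ≤ 2 * ρ₁ ∧ ∑ i : Fin n, y i.succ ^ 2 ≤ (2 * ρ₂) ^ 2}

/-- The envelope of the source. -/
noncomputable def envelope (χ : ℝ → ℝ) (ρ₁ ρ₂ : ℝ) (y : EuclideanSpace ℝ (Fin (n + 1))) : ℝ :=
  χ (y 0 / ρ₁) * χ (Real.sqrt (∑ i : Fin n, y i.succ ^ 2) / ρ₂)

variable {g : EuclideanSpace ℝ (Fin (n + 1)) → ℝ} {k ρ₁ ρ₂ : ℝ}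

lemma BeamScales.length_pos (h : BeamScales g k ρ₁ ρ₂) : 0 < ρ₁ := h.width_pos.trans_le h.width_le

lemma isOpen_beamTarget : IsOpen (beamTarget n ρ₁ ρ₂) :=
  Metric.isOpen_ball.preimage (continuous_rescale _ _)

lemma beamTarget_coord (h : BeamScales g k ρ₁ ρ₂) {x : EuclideanSpace ℝ (Fin (n + 1))}
    (hx : x ∈ beamTarget n ρ₁ ρ₂) :
    9 * ρ₁ ≤ x 0 ∧ x 0 ≤ 11 * ρ₁ ∧ ∑ i : Fin n, x i.succ ^ 2 ≤ ρ₂ ^ 2 := by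
  have h1 := h.length_pos
  have h2 := h.width_pos
  have hx' : ‖rescale n ρ₁⁻¹ ρ₂⁻¹ x - EuclideanSpace.single 0 10‖ ^ 2 < 1 := by
    have : ‖rescale n ρ₁⁻¹ ρ₂⁻¹ x - EuclideanSpace.single 0 10‖ < 1 := by
      simpa [beamTarget, dist_eq_norm] using hx
    nlinarith [norm_nonneg (rescale n ρ₁⁻¹ ρ₂⁻¹ x - EuclideanSpace.single 0 10)]
  rw [norm_sq_eq_zero_add_succ] at hx'
  simp only [PiLp.sub_apply, rescale_zero, rescale_succ, PiLp.single_apply,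
    if_true, Fin.succ_ne_zero, if_false, sub_zero, mul_pow, ← Finset.mul_sum] at hx'
  have h3 : 0 ≤ ∑ i : Fin n, x i.succ ^ 2 := by positivity
  have h4 : 0 ≤ (ρ₂⁻¹) ^ 2 * ∑ i : Fin n, x i.succ ^ 2 := by positivity
  have h5 : |ρ₁⁻¹ * x 0 - 10| ≤ 1 := by
    rw [← sq_le_one_iff_abs_le_one]
    linarith
  have h6 : (ρ₂⁻¹) ^ 2 * ∑ i : Fin n, x i.succ ^ 2 ≤ 1 := by
    nlinarith [sq_nonneg (ρ₁⁻¹ * x 0 - 10)]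
  obtain ⟨h7, h8⟩ := abs_le.1 h5
  have h9 : ρ₁⁻¹ * x 0 = x 0 / ρ₁ := by ring
  rw [h9] at h7 h8
  refine ⟨?_, ?_, ?_⟩
  · have : 9 ≤ x 0 / ρ₁ := by linarith
    rwa [le_div_iff₀ h1] at this
  · have : x 0 / ρ₁ ≤ 11 := by linarith
    rwa [div_le_iff₀ h1] at this
  · rw [inv_pow, inv_mul_le_iff₀ (by positivity), mul_one] at h6
    exact h6

/-- Since $\rho_2\le\rho_1$, the squared norm is at most $(11^2+1)\rho_1^2\le(12\rho_1)^2$. -/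
lemma norm_le_of_mem_beamTarget (h : BeamScales g k ρ₁ ρ₂) {x : EuclideanSpace ℝ (Fin (n + 1))}
    (hx : x ∈ beamTarget n ρ₁ ρ₂) : ‖x‖ ≤ 12 * ρ₁ := by
  have h1 := h.length_pos
  have h2 := h.width_pos
  have h3 := h.width_le
  obtain ⟨h4, h5, h6⟩ := beamTarget_coord h hx
  refine le_of_sq_le_sq ?_ (by positivity)
  rw [norm_sq_eq_zero_add_succ]
  nlinarith

lemma norm_le_of_mem_beamSource (h : BeamScales g k ρ₁ ρ₂) {y : EuclideanSpace ℝ (Fin (n + 1))}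
    (hy : y ∈ beamSource n ρ₁ ρ₂) : ‖y‖ ≤ 12 * ρ₁ := by
  have h1 := h.length_pos
  have h2 := h.width_pos
  have h3 := h.width_le
  obtain ⟨h5, h6⟩ := hy
  obtain ⟨h7, h8⟩ := abs_le.1 h5
  refine le_of_sq_le_sq ?_ (by positivity)
  rw [norm_sq_eq_zero_add_succ]
  nlinarith

lemma beamTarget_subset_ball (h : BeamScales g k ρ₁ ρ₂) :
    beamTarget n ρ₁ ρ₂ ⊆ Metric.ball 0 1 := fun x hx => by
  have := norm_le_of_mem_beamTarget h hx
  have := h.length_lt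
  rw [mem_ball_zero_iff]
  linarith

/-- The heart of the matter: transverse and normal displacements enter $r^2-D^2$ quadratically, and
dividing by $r+D\ge14\rho_1$ leaves a phase error bounded independently of $k$. -/
lemma dist_graphMap_bounds (h : BeamScales g k ρ₁ ρ₂) {x y : EuclideanSpace ℝ (Fin (n + 1))}
    (hx : x ∈ beamTarget n ρ₁ ρ₂) (hy : y ∈ beamSource n ρ₁ ρ₂) :
    7 * ρ₁ ≤ dist (graphMap g x) (graphMap g y) ∧
    dist (graphMap g x) (graphMap g y) ≤ 14 * ρ₁ ∧
    |k * (dist (graphMap g x) (graphMap g y) - (x 0 - y 0))| ≤ 1 / 40 := by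
  have h1 := h.length_pos
  have h2 := h.width_pos
  have h3 := h.width_le
  have hk := h.k_pos
  obtain ⟨h4, h5, h6⟩ := beamTarget_coord h hx
  obtain ⟨h7, h8⟩ := hy
  obtain ⟨h9, h10⟩ := abs_le.1 h7
  have hq := h.normal x y (norm_le_of_mem_beamTarget h hx) (norm_le_of_mem_beamSource h ⟨h7, h8⟩)
  have hr := dist_graphMap_sq (g := g) x y
  rw [dist_eq_norm x y, norm_sq_eq_zero_add_succ] at hr
  simp only [PiLp.sub_apply] at hr
  have hs : ∑ i : Fin n, (x i.succ - y i.succ) ^ 2 ≤ 10 * ρ₂ ^ 2 := by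
    calc ∑ i : Fin n, (x i.succ - y i.succ) ^ 2
        ≤ ∑ i : Fin n, (2 * x i.succ ^ 2 + 2 * y i.succ ^ 2) :=
          Finset.sum_le_sum fun i _ => by nlinarith [sq_nonneg (x i.succ + y i.succ)]
      _ = 2 * ∑ i : Fin n, x i.succ ^ 2 + 2 * ∑ i : Fin n, y i.succ ^ 2 := by
          rw [Finset.sum_add_distrib, Finset.mul_sum, Finset.mul_sum]
      _ ≤ 10 * ρ₂ ^ 2 := by nlinarith
  have hs0 : 0 ≤ ∑ i : Fin n, (x i.succ - y i.succ) ^ 2 := by positivity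
  set r := dist (graphMap g x) (graphMap g y)
  set s := ∑ i : Fin n, (x i.succ - y i.succ) ^ 2
  set q := (g x - g y) ^ 2 with hqdef
  have hq0 : 0 ≤ q := sq_nonneg _
  have hr0 : 0 ≤ r := dist_nonneg
  set D := x 0 - y 0 with hD
  have hD1 : 7 * ρ₁ ≤ D := by linarith
  have hD2 : D ≤ 13 * ρ₁ := by linarith
  have hDr : D ≤ r := le_of_sq_le_sq (by linarith) hr0
  -- The transverse part contributes $10k\rho_2^2\le\rho_1/10$ and the normal part $\rho_1/4$.
  -- Dividing $7\rho_1/20$ by $14\rho_1$ gives $1/40$.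
  have hkey : k * ((r - D) * (r + D)) ≤ 7 / 20 * ρ₁ := by
    have : (r - D) * (r + D) = s + q := by linarith [hr]
    rw [this]
    have := h.transverse
    have : k * s ≤ k * (10 * ρ₂ ^ 2) := by gcongr
    nlinarith
  have hkr : k * (r - D) ≤ 1 / 40 := by
    have h0 : 0 ≤ k * (r - D) := mul_nonneg hk.le (by linarith)
    have : k * (r - D) * (14 * ρ₁) ≤ 1 / 40 * (14 * ρ₁) := by
      calc k * (r - D) * (14 * ρ₁) ≤ k * (r - D) * (r + D) := by gcongr; linarith
        _ ≤ 1 / 40 * (14 * ρ₁) := by linarith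
    exact le_of_mul_le_mul_right this (by positivity)
  refine ⟨by linarith, ?_, ?_⟩
  · have h11 : k * (r - D) ≤ k * ρ₁ := by linarith [h.one_le]
    have := le_of_mul_le_mul_left h11 hk
    linarith
  · rw [abs_of_nonneg (mul_nonneg hk.le (by linarith))]
    exact hkr

lemma norm_exp_I_mul_sub_one_le (s : ℝ) : ‖Complex.exp (Complex.I * (s : ℂ)) - 1‖ ≤ |s| := by
  simpa using Real.norm_exp_I_mul_ofReal_sub_one_le (x := s)

/-- After removing the phase, the kernel is comparable to its amplitude along the beam. -/
lemma radialSol_beam (h : BeamScales g k ρ₁ ρ₂) {Z : ℝ}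
    (hZ : ∀ z ≥ Z, ‖normalizedHankel n z - 1‖ ≤ 1 / 4) (hkZ : Z ≤ k * ρ₁)
    {x y : EuclideanSpace ℝ (Fin (n + 1))}
    (hx : x ∈ beamTarget n ρ₁ ρ₂) (hy : y ∈ beamSource n ρ₁ ρ₂) :
    ∃ v : ℂ, ‖v - 1‖ ≤ 1 / 2 ∧
      (phaseConst n)⁻¹ * Complex.exp (-(Complex.I * ((k * x 0 : ℝ) : ℂ)))
        * (radialSol n k (dist (graphMap g x) (graphMap g y))
          * Complex.exp (Complex.I * ((k * y 0 : ℝ) : ℂ)))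
      = (amplitude n k (dist (graphMap g x) (graphMap g y)) : ℂ) * v := by
  obtain ⟨h1, h2, h3⟩ := dist_graphMap_bounds h hx hy
  set r := dist (graphMap g x) (graphMap g y)
  have hz := hZ (k * r) (hkZ.trans (by
    have := h.length_pos
    have := h.k_pos
    gcongr
    linarith))
  set N := normalizedHankel n (k * r) with hN
  -- The factor $v$ collects the phase error, within $1/40$ of 1, and the normalised Hankel
  -- integral, within $1/4$ of 1.
  refine ⟨Complex.exp (Complex.I * ((k * (r - (x 0 - y 0)) : ℝ) : ℂ)) * N, ?_, ?_⟩
  · have h4 := (norm_exp_I_mul_sub_one_le (k * (r - (x 0 - y 0)))).trans h3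
    set e := Complex.exp (Complex.I * ((k * (r - (x 0 - y 0)) : ℝ) : ℂ))
    have h5 : ‖N‖ ≤ 5 / 4 := by
      calc ‖N‖ = ‖(N - 1) + 1‖ := by ring_nf
        _ ≤ ‖N - 1‖ + ‖(1 : ℂ)‖ := norm_add_le _ _
        _ ≤ 5 / 4 := by rw [norm_one]; linarith
    calc ‖e * N - 1‖ = ‖(e - 1) * N + (N - 1)‖ := by ring_nf
      _ ≤ ‖e - 1‖ * ‖N‖ + ‖N - 1‖ := (norm_add_le _ _).trans (by rw [norm_mul])
      _ ≤ 1 / 40 * (5 / 4) + 1 / 4 := by gcongr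
      _ ≤ 1 / 2 := by norm_num
  · have h6 : phaseConst n ≠ 0 := by
      rw [← norm_pos_iff, norm_phaseConst]
      exact one_pos
    have h7 : Complex.exp (Complex.I * ((k * (r - (x 0 - y 0)) : ℝ) : ℂ))
        = Complex.exp (-(Complex.I * ((k * x 0 : ℝ) : ℂ)))
          * Complex.exp (Complex.I * ((k * r : ℝ) : ℂ))
          * Complex.exp (Complex.I * ((k * y 0 : ℝ) : ℂ)) := by
      rw [← Complex.exp_add, ← Complex.exp_add]
      congr 1
      push_cast
      ring
    rw [h7, radialSol, ← hN]
    field_simp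

lemma envelope_nonneg {χ : ℝ → ℝ} (hχ : ∀ t, 0 ≤ χ t) (y : EuclideanSpace ℝ (Fin (n + 1))) :
    0 ≤ envelope χ ρ₁ ρ₂ y := mul_nonneg (hχ _) (hχ _)

lemma envelope_eq_zero (h₁ : 0 < ρ₁) (h₂ : 0 < ρ₂) {χ : ℝ → ℝ} (hχ : tsupport χ ⊆ Icc (-2) 2)
    {y : EuclideanSpace ℝ (Fin (n + 1))} (hy : y ∉ beamSource n ρ₁ ρ₂) :
    envelope χ ρ₁ ρ₂ y = 0 := by
  by_contra hne
  refine hy ⟨?_, ?_⟩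
  · have h := hχ (subset_tsupport _ (left_ne_zero_of_mul hne))
    have := abs_le.2 h
    rwa [abs_div, abs_of_pos h₁, div_le_iff₀ h₁] at this
  · have h := (hχ (subset_tsupport _ (right_ne_zero_of_mul hne))).2
    rw [div_le_iff₀ h₂, Real.sqrt_le_iff] at h
    exact h.2

lemma envelope_eq_one {χ : ℝ → ℝ}
    (hχ : ∀ t ∈ Icc (-1 : ℝ) 1, χ t = 1) {y : EuclideanSpace ℝ (Fin (n + 1))}
    (hy : y ∈ rescale n ρ₁⁻¹ ρ₂⁻¹ ⁻¹' Metric.ball 0 1) : envelope χ ρ₁ ρ₂ y = 1 := by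
  have hy' : ‖rescale n ρ₁⁻¹ ρ₂⁻¹ y‖ ^ 2 < 1 := by
    have : ‖rescale n ρ₁⁻¹ ρ₂⁻¹ y‖ < 1 := by simpa using hy
    nlinarith [norm_nonneg (rescale n ρ₁⁻¹ ρ₂⁻¹ y)]
  rw [norm_sq_eq_zero_add_succ] at hy'
  simp only [rescale_zero, rescale_succ, mul_pow, ← Finset.mul_sum] at hy'
  have h3 : 0 ≤ ∑ i : Fin n, y i.succ ^ 2 := by positivity
  have h4 : 0 ≤ (ρ₂⁻¹) ^ 2 * ∑ i : Fin n, y i.succ ^ 2 := by positivity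
  have h5 : |y 0 / ρ₁| ≤ 1 := by
    rw [← sq_le_one_iff_abs_le_one, div_eq_inv_mul, mul_pow]
    linarith
  have h6 : |Real.sqrt (∑ i : Fin n, y i.succ ^ 2) / ρ₂| ≤ 1 := by
    rw [← sq_le_one_iff_abs_le_one, div_eq_inv_mul, mul_pow, Real.sq_sqrt h3]
    nlinarith [sq_nonneg (ρ₁⁻¹), sq_nonneg (y 0), mul_nonneg (sq_nonneg (ρ₁⁻¹)) (sq_nonneg (y 0))]
  rw [envelope, hχ _ (abs_le.1 h5), hχ _ (abs_le.1 h6), one_mul]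

lemma continuous_envelope {χ : ℝ → ℝ} (hχ : Continuous χ) :
    Continuous (envelope χ ρ₁ ρ₂ : EuclideanSpace ℝ (Fin (n + 1)) → ℝ) := by
  unfold envelope
  fun_prop

end Pointwise

/-! ### Size of the potential on the target and of the source -/

section Field

variable {n : ℕ} {g : EuclideanSpace ℝ (Fin (n + 1)) → ℝ} {k ρ₁ ρ₂ : ℝ} {χ : ℝ → ℝ}
  {u : EuclideanSpace ℝ (Fin (n + 2)) → ℂ}

/-- `u` is the plane wave `e^{ikx₁}` with envelope `χ(x₁/ρ₁)χ(|x''|/ρ₂)` on the graph of `g`. -/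
def IsBeam (g : EuclideanSpace ℝ (Fin (n + 1)) → ℝ) (χ : ℝ → ℝ) (k ρ₁ ρ₂ : ℝ)
    (u : EuclideanSpace ℝ (Fin (n + 2)) → ℂ) : Prop :=
  ∀ y, u (graphMap g y)
    = Complex.exp (Complex.I * ((k * y 0 : ℝ) : ℂ)) * (envelope χ ρ₁ ρ₂ y : ℂ)

lemma IsBeam.norm_eq (hu : IsBeam g χ k ρ₁ ρ₂ u) (hχ : ∀ t, 0 ≤ χ t)
    (y : EuclideanSpace ℝ (Fin (n + 1))) : ‖u (graphMap g y)‖ = envelope χ ρ₁ ρ₂ y := by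
  rw [hu y, norm_mul, mul_comm Complex.I, Complex.norm_exp_ofReal_mul_I, one_mul,
    Complex.norm_real, Real.norm_of_nonneg (envelope_nonneg hχ y)]

lemma IsBeam.continuous (hu : IsBeam g χ k ρ₁ ρ₂ u) (hχ : Continuous χ) :
    Continuous fun y => u (graphMap g y) := by
  have : (fun y => u (graphMap g y)) = fun y : EuclideanSpace ℝ (Fin (n + 1)) =>
      Complex.exp (Complex.I * ((k * y 0 : ℝ) : ℂ)) * (envelope χ ρ₁ ρ₂ y : ℂ) := funext hu
  rw [this]
  have := continuous_envelope (n := n) (ρ₁ := ρ₁) (ρ₂ := ρ₂) hχ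
  fun_prop

lemma exists_envelope_le (hχ : Continuous χ) (hs : tsupport χ ⊆ Icc (-2) 2) (h0 : ∀ t, 0 ≤ χ t) :
    ∃ M > 0, ∀ (n : ℕ) (ρ₁ ρ₂ : ℝ) (y : EuclideanSpace ℝ (Fin (n + 1))),
      envelope χ ρ₁ ρ₂ y ≤ M := by
  have hc : HasCompactSupport χ := isCompact_Icc.of_isClosed_subset (isClosed_tsupport _) hs
  obtain ⟨C, hC⟩ := hc.exists_bound_of_continuous hχ
  have hC0 : 0 ≤ C := (norm_nonneg _).trans (hC 0)
  refine ⟨C * C + 1, by positivity, fun n ρ₁ ρ₂ y => ?_⟩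
  have h1 := (le_abs_self _).trans (hC (y 0 / ρ₁))
  have h2 := (le_abs_self _).trans (hC (Real.sqrt (∑ i : Fin n, y i.succ ^ 2) / ρ₂))
  have := mul_le_mul h1 h2 (h0 _) hC0
  rw [envelope]
  linarith

lemma BeamScales.isFiniteMeasure (h : BeamScales g k ρ₁ ρ₂) :
    IsFiniteMeasure (graphMeasure g) :=
  ⟨graphMeasure_univ_lt_top h.differentiable.continuous h.lipschitz⟩

lemma integrable_envelope (h : BeamScales g k ρ₁ ρ₂) (hχ : Continuous χ)
    (hs : tsupport χ ⊆ Icc (-2) 2) (h0 : ∀ t, 0 ≤ χ t) :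
    Integrable (envelope χ ρ₁ ρ₂) (graphMeasure g) := by
  have := h.isFiniteMeasure
  obtain ⟨M, -, hM⟩ := exists_envelope_le hχ hs h0
  refine Integrable.of_bound (continuous_envelope hχ).aestronglyMeasurable M
    (ae_of_all _ fun y => ?_)
  rw [Real.norm_of_nonneg (envelope_nonneg h0 y)]
  exact hM _ _ _ _

/-- The single-layer potential in the coordinates `x'`. -/
lemma singleLayer_graphMap_eq (h : BeamScales g k ρ₁ ρ₂) (x : EuclideanSpace ℝ (Fin (n + 1))) :
    singleLayer g k u (graphMap g x) = ∫ y, radialSol n k (dist (graphMap g x) (graphMap g y))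
      * u (graphMap g y) ∂(graphMeasure g) := by
  rw [singleLayer_graphMap h.differentiable.continuous]
  simp only [fundSol_eq_radialSol]

lemma measurable_kernel (h : BeamScales g k ρ₁ ρ₂) (hχ : Continuous χ)
    (hu : IsBeam g χ k ρ₁ ρ₂ u) :
    Measurable fun p : EuclideanSpace ℝ (Fin (n + 1)) × EuclideanSpace ℝ (Fin (n + 1)) =>
      radialSol n k (dist (graphMap g p.1) (graphMap g p.2)) * u (graphMap g p.2) := by
  have h1 := (continuous_graphMap h.differentiable.continuous).measurable
  refine Measurable.mul ((measurable_radialSol n k).comp ?_)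
    ((hu.continuous hχ).measurable.comp measurable_snd)
  exact (h1.comp measurable_fst).dist (h1.comp measurable_snd)

lemma measurable_singleLayer_graphMap (h : BeamScales g k ρ₁ ρ₂) (hχ : Continuous χ)
    (hu : IsBeam g χ k ρ₁ ρ₂ u) : Measurable fun x => singleLayer g k u (graphMap g x) := by
  have := h.isFiniteMeasure
  simp only [singleLayer_graphMap_eq h]
  exact (measurable_kernel h hχ hu).stronglyMeasurable.integral_prod_right.measurable

lemma norm_le_of_norm_sub_one_le {v : ℂ} (hv : ‖v - 1‖ ≤ 1 / 2) : ‖v‖ ≤ 3 / 2 := by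
  have h := norm_add_le (v - 1) 1
  rw [sub_add_cancel, norm_one] at h
  linarith

lemma le_re_of_norm_sub_one_le {v : ℂ} (hv : ‖v - 1‖ ≤ 1 / 2) : 1 / 2 ≤ v.re := by
  have h := (abs_le.1 (Complex.abs_re_le_norm (v - 1))).1
  simp only [Complex.sub_re, Complex.one_re] at h
  linarith

lemma norm_phase_mul (n : ℕ) (s : ℝ) (w : ℂ) :
    ‖(phaseConst n)⁻¹ * Complex.exp (-(Complex.I * (s : ℂ))) * w‖ = ‖w‖ := by
  have : -(Complex.I * (s : ℂ)) = ((-s : ℝ) : ℂ) * Complex.I := by push_cast; ring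
  rw [norm_mul, norm_mul, norm_inv, norm_phaseConst, this, Complex.norm_exp_ofReal_mul_I]
  simp

/-- On the source box the integrand without its phase is amplitude times envelope times some $v$
with $|v-1|\le1/2$, hence $|v|\le3/2$ and $\operatorname{Re}v\ge1/2$. Off the box everything
vanishes. Freezing the amplitude at $14\rho_1$ makes both bounds independent of $x$. -/
lemma kernel_bounds (h : BeamScales g k ρ₁ ρ₂) {Z : ℝ}
    (hZ : ∀ z ≥ Z, ‖normalizedHankel n z - 1‖ ≤ 1 / 4) (hkZ : Z ≤ k * ρ₁)
    (hs : tsupport χ ⊆ Icc (-2) 2) (h0 : ∀ t, 0 ≤ χ t) (hu : IsBeam g χ k ρ₁ ρ₂ u)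
    {x : EuclideanSpace ℝ (Fin (n + 1))} (hx : x ∈ beamTarget n ρ₁ ρ₂)
    (y : EuclideanSpace ℝ (Fin (n + 1))) :
    ‖radialSol n k (dist (graphMap g x) (graphMap g y)) * u (graphMap g y)‖
      ≤ 3 / 2 * 2 ^ (((n : ℝ) + 1) / 2) * amplitude n k (14 * ρ₁) * envelope χ ρ₁ ρ₂ y ∧
    1 / 2 * amplitude n k (14 * ρ₁) * envelope χ ρ₁ ρ₂ y ≤
      ((phaseConst n)⁻¹ * Complex.exp (-(Complex.I * ((k * x 0 : ℝ) : ℂ)))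
        * (radialSol n k (dist (graphMap g x) (graphMap g y)) * u (graphMap g y))).re := by
  by_cases hy : y ∈ beamSource n ρ₁ ρ₂
  · obtain ⟨v, hv, hv'⟩ := radialSol_beam h hZ hkZ hx hy
    obtain ⟨hr1, hr2, -⟩ := dist_graphMap_bounds h hx hy
    have hρ := h.length_pos
    have hk := h.k_pos
    set r := dist (graphMap g x) (graphMap g y)
    have hr0 : 0 < r := by linarith
    have ha1 := amplitude_anti n hk hr0 hr2
    have ha2 := amplitude_anti n hk (by positivity) hr1
    have hhalf := amplitude_half n hk (r := 14 * ρ₁) (by positivity)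
    rw [show 14 * ρ₁ / 2 = 7 * ρ₁ by ring] at hhalf
    rw [hhalf] at ha2
    have hae := envelope_nonneg (ρ₁ := ρ₁) (ρ₂ := ρ₂) h0 y
    have hpos := (amplitude_pos n hk hr0).le
    have hpos' := (amplitude_pos n hk (r := 14 * ρ₁) (by positivity)).le
    have heq : (phaseConst n)⁻¹ * Complex.exp (-(Complex.I * ((k * x 0 : ℝ) : ℂ)))
        * (radialSol n k r * u (graphMap g y))
        = ((amplitude n k r * envelope χ ρ₁ ρ₂ y : ℝ) : ℂ) * v := by
      rw [hu y]
      push_cast at hv' ⊢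
      linear_combination (envelope χ ρ₁ ρ₂ y : ℂ) * hv'
    constructor
    · rw [← norm_phase_mul n (k * x 0), heq, norm_mul, Complex.norm_real,
        Real.norm_of_nonneg (by positivity)]
      calc amplitude n k r * envelope χ ρ₁ ρ₂ y * ‖v‖
          ≤ (2 ^ (((n : ℝ) + 1) / 2) * amplitude n k (14 * ρ₁)) * envelope χ ρ₁ ρ₂ y * (3 / 2) := by
            gcongr
            exact norm_le_of_norm_sub_one_le hv
        _ = _ := by ring
    · rw [heq, Complex.re_ofReal_mul]
      calc 1 / 2 * amplitude n k (14 * ρ₁) * envelope χ ρ₁ ρ₂ y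
          = amplitude n k (14 * ρ₁) * envelope χ ρ₁ ρ₂ y * (1 / 2) := by ring
        _ ≤ _ := by
            gcongr
            exact le_re_of_norm_sub_one_le hv
  · have he := envelope_eq_zero h.length_pos h.width_pos hs hy
    rw [hu y, he]
    simp

lemma integrable_kernel (h : BeamScales g k ρ₁ ρ₂) {Z : ℝ}
    (hZ : ∀ z ≥ Z, ‖normalizedHankel n z - 1‖ ≤ 1 / 4) (hkZ : Z ≤ k * ρ₁)
    (hχ : Continuous χ) (hs : tsupport χ ⊆ Icc (-2) 2) (h0 : ∀ t, 0 ≤ χ t)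
    (hu : IsBeam g χ k ρ₁ ρ₂ u)
    {x : EuclideanSpace ℝ (Fin (n + 1))} (hx : x ∈ beamTarget n ρ₁ ρ₂) :
    Integrable (fun y => radialSol n k (dist (graphMap g x) (graphMap g y)) * u (graphMap g y))
      (graphMeasure g) :=
  ((integrable_envelope h hχ hs h0).const_mul _).mono'
    ((measurable_kernel h hχ hu).comp measurable_prodMk_left).aestronglyMeasurable
    (ae_of_all _ fun y => (kernel_bounds h hZ hkZ hs h0 hu hx y).1)

/-- The size of the potential along the beam, up to a constant. -/
noncomputable def beamSize (g : EuclideanSpace ℝ (Fin (n + 1)) → ℝ) (χ : ℝ → ℝ)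
    (k ρ₁ ρ₂ : ℝ) : ℝ :=
  1 / 2 * amplitude n k (14 * ρ₁) * ∫ y, envelope χ ρ₁ ρ₂ y ∂(graphMeasure g)

lemma norm_singleLayer_le (h : BeamScales g k ρ₁ ρ₂) {Z : ℝ}
    (hZ : ∀ z ≥ Z, ‖normalizedHankel n z - 1‖ ≤ 1 / 4) (hkZ : Z ≤ k * ρ₁)
    (hχ : Continuous χ) (hs : tsupport χ ⊆ Icc (-2) 2) (h0 : ∀ t, 0 ≤ χ t)
    (hu : IsBeam g χ k ρ₁ ρ₂ u)
    {x : EuclideanSpace ℝ (Fin (n + 1))} (hx : x ∈ beamTarget n ρ₁ ρ₂) :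
    ‖singleLayer g k u (graphMap g x)‖
      ≤ 3 * 2 ^ (((n : ℝ) + 1) / 2) * beamSize g χ k ρ₁ ρ₂ := by
  rw [singleLayer_graphMap_eq h]
  refine (norm_integral_le_of_norm_le ((integrable_envelope h hχ hs h0).const_mul _)
    (ae_of_all _ fun y => (kernel_bounds h hZ hkZ hs h0 hu hx y).1)).trans_eq ?_
  rw [integral_const_mul, beamSize]
  ring

/-- The removed phase depends on $x$ only, so it passes through the integral, and the pointwise
lower bound on real parts can be integrated: no cancellation occurs. -/
lemma beamSize_le_re (h : BeamScales g k ρ₁ ρ₂) {Z : ℝ}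
    (hZ : ∀ z ≥ Z, ‖normalizedHankel n z - 1‖ ≤ 1 / 4) (hkZ : Z ≤ k * ρ₁)
    (hχ : Continuous χ) (hs : tsupport χ ⊆ Icc (-2) 2) (h0 : ∀ t, 0 ≤ χ t)
    (hu : IsBeam g χ k ρ₁ ρ₂ u)
    {x : EuclideanSpace ℝ (Fin (n + 1))} (hx : x ∈ beamTarget n ρ₁ ρ₂) :
    beamSize g χ k ρ₁ ρ₂ ≤ ((phaseConst n)⁻¹ * Complex.exp (-(Complex.I * ((k * x 0 : ℝ) : ℂ)))
        * singleLayer g k u (graphMap g x)).re := by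
  have hi := (integrable_kernel h hZ hkZ hχ hs h0 hu hx).const_mul
    ((phaseConst n)⁻¹ * Complex.exp (-(Complex.I * ((k * x 0 : ℝ) : ℂ))))
  rw [singleLayer_graphMap_eq h, ← integral_const_mul, beamSize, ← integral_const_mul]
  have h1 := integral_re hi
  simp only [RCLike.re_to_complex] at h1
  rw [← h1]
  exact integral_mono ((integrable_envelope h hχ hs h0).const_mul _) hi.re
    fun y => (kernel_bounds h hZ hkZ hs h0 hu hx y).2

lemma rescale_preimage_ball_subset (h : BeamScales g k ρ₁ ρ₂) :
    rescale n ρ₁⁻¹ ρ₂⁻¹ ⁻¹' Metric.ball 0 1 ⊆ Metric.ball 0 1 := by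
  intro x hx
  have h1 := norm_rescale_le h.width_pos.le h.width_le (rescale n ρ₁⁻¹ ρ₂⁻¹ x)
  rw [rescale_rescale_inv h.length_pos.ne' h.width_pos.ne'] at h1
  have h2 : ‖rescale n ρ₁⁻¹ ρ₂⁻¹ x‖ < 1 := by simpa using hx
  have := h.length_pos
  have := h.length_lt
  rw [mem_ball_zero_iff]
  nlinarith

/-- A lower bound for the mass of the source. -/
lemma le_integral_envelope (h : BeamScales g k ρ₁ ρ₂)
    (hχ : Continuous χ) (hs : tsupport χ ⊆ Icc (-2) 2) (h0 : ∀ t, 0 ≤ χ t)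
    (h1 : ∀ t ∈ Icc (-1 : ℝ) 1, χ t = 1) :
    ρ₁ * ρ₂ ^ n * (volume (Metric.ball (0 : EuclideanSpace ℝ (Fin (n + 1))) 1)).toReal
      ≤ ∫ y, envelope χ ρ₁ ρ₂ y ∂(graphMeasure g) := by
  have := h.isFiniteMeasure
  have hρ := h.length_pos
  have hρ' := h.width_pos
  set B := rescale n ρ₁⁻¹ ρ₂⁻¹ ⁻¹' Metric.ball 0 1 with hB
  have hBm : MeasurableSet B :=
    (Metric.isOpen_ball.preimage (continuous_rescale _ _)).measurableSet
  have h2 : volume B ≤ graphMeasure g B := by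
    have := volume_restrict_le_graphMeasure h.differentiable.continuous B
    rwa [Measure.restrict_apply hBm,
      inter_eq_self_of_subset_left (rescale_preimage_ball_subset h)] at this
  rw [hB, volume_rescale_preimage hρ hρ' Metric.isOpen_ball.measurableSet] at h2
  have h3 := ENNReal.toReal_mono (measure_ne_top _ _) h2
  rw [ENNReal.toReal_mul, ENNReal.toReal_ofReal (by positivity)] at h3
  refine h3.trans ?_
  calc (graphMeasure g B).toReal = ∫ y in B, envelope χ ρ₁ ρ₂ y ∂(graphMeasure g) := by
        rw [setIntegral_congr_fun hBm (g := fun _ => (1 : ℝ))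
          (fun y hy => envelope_eq_one h1 hy)]
        simp [Measure.real]
    _ ≤ _ := setIntegral_le_integral (integrable_envelope h hχ hs h0)
        (ae_of_all _ fun y => envelope_nonneg h0 y)

/-- After rescaling, the two parts of the squared norm are at most 4 each, and $4+4\le3^2$. -/
lemma beamSource_subset (h₁ : 0 < ρ₁) (h₂ : 0 < ρ₂) :
    beamSource n ρ₁ ρ₂ ⊆ rescale n ρ₁⁻¹ ρ₂⁻¹ ⁻¹' Metric.closedBall 0 3 := by
  rintro y ⟨hy1, hy2⟩
  rw [mem_preimage, mem_closedBall_zero_iff]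
  refine le_of_sq_le_sq ?_ (by norm_num)
  rw [norm_sq_eq_zero_add_succ]
  simp only [rescale_zero, rescale_succ, mul_pow, ← Finset.mul_sum]
  have h3 : (ρ₁⁻¹) ^ 2 * y 0 ^ 2 ≤ 4 := by
    rw [inv_pow, inv_mul_le_iff₀ (by positivity)]
    nlinarith [abs_le.1 hy1]
  have h4 : (ρ₂⁻¹) ^ 2 * ∑ i : Fin n, y i.succ ^ 2 ≤ 4 := by
    rw [inv_pow, inv_mul_le_iff₀ (by positivity)]
    linarith
  linarith

/-- An upper bound for the `L²` norm of the source. -/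
lemma l2Norm_beam_le (h : BeamScales g k ρ₁ ρ₂) (hs : tsupport χ ⊆ Icc (-2) 2)
    (h0 : ∀ t, 0 ≤ χ t) (hu : IsBeam g χ k ρ₁ ρ₂ u) {M : ℝ}
    (hM : ∀ y : EuclideanSpace ℝ (Fin (n + 1)), envelope χ ρ₁ ρ₂ y ≤ M) :
    l2Norm g u ≤ ENNReal.ofReal M * (3 ^ (n + 1) * (ENNReal.ofReal (ρ₁ * ρ₂ ^ n)
      * volume (Metric.closedBall (0 : EuclideanSpace ℝ (Fin (n + 1))) 3))) ^ (1 / 2 : ℝ) := by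
  have hρ := h.length_pos
  have hρ' := h.width_pos
  rw [l2Norm_eq h.differentiable.continuous]
  set B := rescale n ρ₁⁻¹ ρ₂⁻¹ ⁻¹' Metric.closedBall 0 3 with hB
  have hBm : MeasurableSet B :=
    (Metric.isClosed_closedBall.preimage (continuous_rescale _ _)).measurableSet
  have h1 : eLpNorm (fun x => u (graphMap g x)) 2 (graphMeasure g)
      ≤ eLpNorm (B.indicator fun _ => M) 2 (graphMeasure g) := by
    refine eLpNorm_mono fun y => ?_
    rw [hu.norm_eq h0]
    by_cases hy : y ∈ B
    · rw [indicator_of_mem hy]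
      exact (hM y).trans (le_abs_self _)
    · rw [indicator_of_notMem hy, norm_zero,
        envelope_eq_zero hρ hρ' hs fun hy' => hy (beamSource_subset hρ hρ' hy')]
  have h2 : graphMeasure g B ≤ 3 ^ (n + 1) * (ENNReal.ofReal (ρ₁ * ρ₂ ^ n)
      * volume (Metric.closedBall (0 : EuclideanSpace ℝ (Fin (n + 1))) 3)) := by
    rw [← volume_rescale_preimage hρ hρ' Metric.isClosed_closedBall.measurableSet]
    exact graphMeasure_le h.differentiable.continuous h.lipschitz B
  have hM0 : 0 ≤ M := (envelope_nonneg h0 0).trans (hM 0)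
  refine h1.trans ?_
  rw [eLpNorm_indicator_const hBm (by norm_num) (by norm_num), Real.enorm_of_nonneg hM0]
  simp only [ENNReal.toReal_ofNat]
  gcongr

lemma memLp_beam (h : BeamScales g k ρ₁ ρ₂) (hχ : Continuous χ) (hs : tsupport χ ⊆ Icc (-2) 2)
    (h0 : ∀ t, 0 ≤ χ t) (hu : IsBeam g χ k ρ₁ ρ₂ u) : MemLp u 2 (surfaceMeasure g) := by
  have := h.isFiniteMeasure
  obtain ⟨M, -, hM⟩ := exists_envelope_le hχ hs h0
  rw [← map_graphMeasure h.differentiable.continuous,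
    (measurableEmbedding_graphMap h.differentiable.continuous).memLp_map_measure_iff]
  exact MemLp.of_bound (hu.continuous hχ).aestronglyMeasurable M
    (ae_of_all _ fun y => by simpa [hu.norm_eq h0] using hM n ρ₁ ρ₂ y)

/-- The `L²` norm over the surface dominates the `L²` norm over the beam in the coordinates. -/
lemma eLpNorm_beamTarget_le (h : BeamScales g k ρ₁ ρ₂)
    (w : EuclideanSpace ℝ (Fin (n + 2)) → ℂ) :
    eLpNorm (fun x => w (graphMap g x)) 2 (volume.restrict (beamTarget n ρ₁ ρ₂)) ≤ l2Norm g w := by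
  rw [l2Norm_eq h.differentiable.continuous]
  refine eLpNorm_mono_measure _ (le_trans ?_
    (volume_restrict_le_graphMeasure h.differentiable.continuous))
  exact Measure.restrict_mono (beamTarget_subset_ball h) le_rfl

lemma l2Norm_beam_pos (h : BeamScales g k ρ₁ ρ₂) (hχ : Continuous χ) (h0 : ∀ t, 0 ≤ χ t)
    (h1 : ∀ t ∈ Icc (-1 : ℝ) 1, χ t = 1) (hu : IsBeam g χ k ρ₁ ρ₂ u) : 0 < l2Norm g u := by
  rw [l2Norm_eq h.differentiable.continuous, pos_iff_ne_zero, Ne,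
    eLpNorm_eq_zero_iff (hu.continuous hχ).aestronglyMeasurable (by norm_num)]
  intro hz
  have hρ := h.length_pos
  have hρ' := h.width_pos
  set B := rescale n ρ₁⁻¹ ρ₂⁻¹ ⁻¹' Metric.ball 0 1
  have hBm : MeasurableSet B :=
    (Metric.isOpen_ball.preimage (continuous_rescale _ _)).measurableSet
  have h2 : graphMeasure g B = 0 := by
    refine measure_mono_null (fun y hy => ?_) hz
    intro hy0
    have h3 := hu.norm_eq h0 y
    rw [envelope_eq_one h1 hy] at h3
    have : u (graphMap g y) = 0 := hy0
    rw [this, norm_zero] at h3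
    exact zero_ne_one h3
  have h4 := volume_restrict_le_graphMeasure h.differentiable.continuous B
  rw [h2, Measure.restrict_apply hBm,
    inter_eq_self_of_subset_left (rescale_preimage_ball_subset h),
    volume_rescale_preimage hρ hρ' Metric.isOpen_ball.measurableSet] at h4
  have h5 : 0 < ENNReal.ofReal (ρ₁ * ρ₂ ^ n) := ENNReal.ofReal_pos.2 (by positivity)
  have h6 := Metric.measure_ball_pos volume (0 : EuclideanSpace ℝ (Fin (n + 1))) one_pos
  exact (ENNReal.mul_pos h5.ne' h6.ne').not_ge h4

end Field

/-! ### Classical differentiability of the potential on the target -/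

section Deriv

open Filter Topology

variable {n : ℕ} {g : EuclideanSpace ℝ (Fin (n + 1)) → ℝ} {k ρ₁ ρ₂ : ℝ} {χ : ℝ → ℝ}
  {u : EuclideanSpace ℝ (Fin (n + 2)) → ℂ}

lemma hasDerivAt_dist_graphMap (hg : Differentiable ℝ g) {x y : EuclideanSpace ℝ (Fin (n + 1))}
    (hxy : 0 < dist (graphMap g x) (graphMap g y)) :
    HasDerivAt (fun t : ℝ => dist (graphMap g (x + t • EuclideanSpace.single 0 1)) (graphMap g y))
      (((x 0 - y 0) + (g x - g y) * fderiv ℝ g x (EuclideanSpace.single 0 1))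
        / dist (graphMap g x) (graphMap g y)) 0 := by
  set e : EuclideanSpace ℝ (Fin (n + 1)) := EuclideanSpace.single 0 1 with he
  have h1 : ∀ t : ℝ, dist (graphMap g (x + t • e)) (graphMap g y)
      = Real.sqrt ((x 0 + t - y 0) ^ 2 + ∑ i : Fin n, (x i.succ - y i.succ) ^ 2
        + (g (x + t • e) - g y) ^ 2) := by
    intro t
    rw [eq_comm, Real.sqrt_eq_iff_mul_self_eq (by positivity) dist_nonneg, ← sq, dist_graphMap_sq,
      dist_eq_norm, norm_sq_eq_zero_add_succ]
    simp [he]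
  have h2 : HasDerivAt (fun t : ℝ => g (x + t • e)) (fderiv ℝ g x e) 0 :=
    (hg x).hasFDerivAt.hasLineDerivAt e
  have h3 : HasDerivAt (fun t : ℝ => (x 0 + t - y 0) ^ 2 + ∑ i : Fin n, (x i.succ - y i.succ) ^ 2
        + (g (x + t • e) - g y) ^ 2)
      (2 * ((x 0 - y 0) + (g x - g y) * fderiv ℝ g x e)) 0 := by
    have ha := ((((hasDerivAt_id (0 : ℝ)).const_add (x 0)).sub_const (y 0)).pow 2).add_const
      (∑ i : Fin n, (x i.succ - y i.succ) ^ 2)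
    have hb := (h2.sub_const (g y)).pow 2
    refine (ha.add hb).congr_deriv ?_
    simp
    ring
  have h4 := h1 0
  simp only [zero_smul, add_zero] at h4
  have h5 := h3.sqrt (by
    simp only [zero_smul, add_zero]
    intro h0
    rw [h0, Real.sqrt_zero] at h4
    exact hxy.ne' h4)
  simp only [zero_smul, add_zero] at h5
  rw [← h4] at h5
  refine (h5.congr_deriv (by field_simp)).congr_of_eventuallyEq ?_
  exact Eventually.of_forall h1

/-- Target and source are at distance at least $7\rho_1$, away from the singularity of the kernel,
so one may differentiate under the integral. The constant is not tracked: existence and boundedness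
suffice for the later integration by parts. -/
lemma exists_hasLineDerivAt_singleLayer (h : BeamScales g k ρ₁ ρ₂) {Z : ℝ}
    (hZ : ∀ z ≥ Z, ‖normalizedHankel n z - 1‖ ≤ 1 / 4) (hkZ : Z ≤ k * ρ₁)
    (hχ : Continuous χ) (hs : tsupport χ ⊆ Icc (-2) 2) (h0 : ∀ t, 0 ≤ χ t)
    (hu : IsBeam g χ k ρ₁ ρ₂ u) :
    ∃ C, ∀ x ∈ beamTarget n ρ₁ ρ₂, ∃ D,
      HasLineDerivAt ℝ (fun x => singleLayer g k u (graphMap g x)) D x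
        (EuclideanSpace.single 0 1) ∧ ‖D‖ ≤ C := by
  have := h.isFiniteMeasure
  have hρ := h.length_pos
  have hk := h.k_pos
  have hg := h.differentiable
  obtain ⟨C₁, hC₁⟩ := exists_norm_deriv_radialSol_le n (14 * ρ₁) hk (r₀ := 7 * ρ₁) (by positivity)
    (by nlinarith [h.one_le])
  obtain ⟨M, hM0, hM⟩ := exists_envelope_le hχ hs h0
  have hC₁0 : 0 ≤ C₁ := (norm_nonneg _).trans (hC₁ (7 * ρ₁) ⟨le_rfl, by linarith⟩).2
  have hlip : ∀ r ∈ Icc (7 * ρ₁) (14 * ρ₁), ∀ s ∈ Icc (7 * ρ₁) (14 * ρ₁),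
      ‖radialSol n k r - radialSol n k s‖ ≤ C₁ * ‖r - s‖ := fun r hr s hs =>
    (convex_Icc _ _).norm_image_sub_le_of_norm_deriv_le (fun t ht => (hC₁ t ht).1)
      (fun t ht => (hC₁ t ht).2) hs hr
  set e : EuclideanSpace ℝ (Fin (n + 1)) := EuclideanSpace.single 0 1 with he
  have hnorm_e : ‖e‖ = 1 := by simp [he]
  set K : EuclideanSpace ℝ (Fin (n + 1)) → EuclideanSpace ℝ (Fin (n + 1)) → ℂ := fun x y =>
    radialSol n k (dist (graphMap g x) (graphMap g y)) * u (graphMap g y) with hK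
  have hKlip : ∀ x ∈ beamTarget n ρ₁ ρ₂, ∀ x' ∈ beamTarget n ρ₁ ρ₂, ∀ y,
      ‖K x y - K x' y‖ ≤ C₁ * 3 * M * ‖x - x'‖ := by
    intro x hx x' hx' y
    by_cases hy : y ∈ beamSource n ρ₁ ρ₂
    · obtain ⟨ha, hb, -⟩ := dist_graphMap_bounds h hx hy
      obtain ⟨ha', hb', -⟩ := dist_graphMap_bounds h hx' hy
      have h1 := hlip _ ⟨ha, hb⟩ _ ⟨ha', hb'⟩
      have h2 : ‖dist (graphMap g x) (graphMap g y) - dist (graphMap g x') (graphMap g y)‖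
          ≤ 3 * ‖x - x'‖ := by
        rw [← dist_eq_norm x x']
        exact (abs_dist_sub_le _ _ _).trans (dist_graphMap_le (h.lipschitz x
          (beamTarget_subset_ball h hx) x' (beamTarget_subset_ball h hx')))
      simp only [hK]
      rw [← sub_mul, norm_mul, hu.norm_eq h0]
      calc _ ≤ C₁ * (3 * ‖x - x'‖) * M := by
            gcongr
            · exact envelope_nonneg h0 y
            · exact h1.trans (by gcongr)
            · exact hM _ _ _ _
        _ = _ := by ring
    · have h3 : u (graphMap g y) = 0 := by
        rw [← norm_eq_zero, hu.norm_eq h0, envelope_eq_zero hρ h.width_pos hs hy]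
      simp only [hK, h3, mul_zero, sub_zero, norm_zero]
      positivity
  refine ⟨C₁ * 3 * M * (graphMeasure g).real univ, fun x hx => ?_⟩
  have hnhds : {t : ℝ | x + t • e ∈ beamTarget n ρ₁ ρ₂} ∈ 𝓝 (0 : ℝ) := by
    have : Continuous fun t : ℝ => x + t • e := by fun_prop
    exact (isOpen_beamTarget.preimage this).mem_nhds (by simpa using hx)
  set K' : EuclideanSpace ℝ (Fin (n + 1)) → ℂ := fun y =>
    ((((x 0 - y 0) + (g x - g y) * fderiv ℝ g x e) / dist (graphMap g x) (graphMap g y) : ℝ) : ℂ)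
      * deriv (radialSol n k) (dist (graphMap g x) (graphMap g y)) * u (graphMap g y) with hK'
  have hderiv : ∀ y, HasDerivAt (fun t : ℝ => K (x + t • e) y) (K' y) 0 := by
    intro y
    by_cases hy : y ∈ beamSource n ρ₁ ρ₂
    · obtain ⟨ha, hb, -⟩ := dist_graphMap_bounds h hx hy
      have h1 := hasDerivAt_dist_graphMap (x := x) (y := y) hg (by linarith)
      have h2 := (hC₁ _ ⟨ha, hb⟩).1.hasDerivAt
      have h3 := HasDerivAt.scomp_of_eq (0 : ℝ) h2 h1 (by simp)
      simpa [hK, hK', Function.comp_def] using h3.mul_const (u (graphMap g y))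
    · have h3 : u (graphMap g y) = 0 := by
        rw [← norm_eq_zero, hu.norm_eq h0, envelope_eq_zero hρ h.width_pos hs hy]
      simpa [hK, hK', h3] using hasDerivAt_const (0 : ℝ) (0 : ℂ)
  have hK'meas : Measurable K' := by
    have h1 := (continuous_graphMap hg.continuous).measurable
    have h2 : Measurable fun y => dist (graphMap g x) (graphMap g y) :=
      measurable_const.dist h1
    have h3 := (hu.continuous hχ).measurable
    have h4 := (measurable_deriv (radialSol n k)).comp h2
    have h5 := hg.continuous.measurable
    refine Measurable.mul (Measurable.mul ?_ h4) h3
    fun_prop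
  have hsub : ∀ t : ℝ, x + t • e - (x + (0 : ℝ) • e) = t • e := fun t => by simp
  -- The bound comes from the Lipschitz estimate for the kernel, which avoids estimating the
  -- derivative of $g$ in the explicit formula.
  have hK'b : ∀ y, ‖K' y‖ ≤ C₁ * 3 * M := fun y => by
    refine (hderiv y).le_of_lip' (by positivity) ?_
    filter_upwards [hnhds] with t ht
    refine (hKlip _ ht _ (by simpa using hx) y).trans_eq ?_
    rw [hsub, norm_smul, hnorm_e, sub_zero, mul_one]
  refine ⟨∫ y, K' y ∂(graphMeasure g), ?_, ?_⟩
  · have hmain := (hasDerivAt_integral_of_dominated_loc_of_lip (μ := graphMeasure g)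
      (F := fun (t : ℝ) y => K (x + t • e) y) (F' := K') (bound := fun _ => C₁ * 3 * M) hnhds
      ?_ ?_ hK'meas.aestronglyMeasurable ?_ (integrable_const _) (ae_of_all _ hderiv)).2
    · refine HasDerivAt.congr_of_eventuallyEq hmain ?_
      exact Eventually.of_forall fun t => singleLayer_graphMap_eq h _
    · exact Eventually.of_forall fun t =>
        ((measurable_kernel h hχ hu).comp measurable_prodMk_left).aestronglyMeasurable
    · exact integrable_kernel h hZ hkZ hχ hs h0 hu (by simpa using hx)
    · refine ae_of_all _ fun y => LipschitzOnWith.of_dist_le_mul fun t ht t' ht' => ?_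
      rw [dist_eq_norm, dist_eq_norm]
      refine (hKlip _ ht _ ht' y).trans_eq ?_
      rw [show x + t • e - (x + t' • e) = (t - t') • e by rw [sub_smul]; abel, norm_smul, hnorm_e,
        mul_one, Real.coe_nnabs, abs_of_nonneg (by positivity)]
  · refine (norm_integral_le_of_norm_le_const (ae_of_all _ hK'b)).trans_eq ?_
    rfl

end Deriv

/-! ### Lower bound for a derivative by pairing with a modulated bump -/

section Duality

open Filter Topology

variable {n : ℕ} {g : EuclideanSpace ℝ (Fin (n + 1)) → ℝ} {k ρ₁ ρ₂ : ℝ}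

/-- A bump function around the centre of the rescaled region of observation. -/
noncomputable def unitBump (n : ℕ) :
    ContDiffBump (EuclideanSpace.single 0 10 : EuclideanSpace ℝ (Fin (n + 1))) :=
  ⟨1 / 4, 1 / 2, by norm_num, by norm_num⟩

/-- A bump function in the region of observation. -/
noncomputable def beamBump (n : ℕ) (ρ₁ ρ₂ : ℝ) (x : EuclideanSpace ℝ (Fin (n + 1))) : ℝ :=
  unitBump n (rescale n ρ₁⁻¹ ρ₂⁻¹ x)

/-- The derivative of `beamBump` in the direction of the beam. -/
noncomputable def beamBumpDeriv (n : ℕ) (ρ₁ ρ₂ : ℝ) (x : EuclideanSpace ℝ (Fin (n + 1))) : ℝ :=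
  ρ₁⁻¹ * fderiv ℝ (unitBump n) (rescale n ρ₁⁻¹ ρ₂⁻¹ x) (EuclideanSpace.single 0 1)

lemma contDiff_beamBump : ContDiff ℝ ∞ (beamBump n ρ₁ ρ₂) :=
  (unitBump n).contDiff.comp (LinearMap.toContinuousLinearMap (rescale n ρ₁⁻¹ ρ₂⁻¹)).contDiff

lemma rescale_single (a b : ℝ) :
    rescale n a b (EuclideanSpace.single 0 1) = a • EuclideanSpace.single 0 1 := by
  ext i
  refine Fin.cases ?_ (fun j => ?_) i <;> simp

lemma hasLineDerivAt_beamBump (x : EuclideanSpace ℝ (Fin (n + 1))) :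
    HasLineDerivAt ℝ (beamBump n ρ₁ ρ₂) (beamBumpDeriv n ρ₁ ρ₂ x) x
      (EuclideanSpace.single 0 1) := by
  have h1 : HasFDerivAt (unitBump n) _ (rescale n ρ₁⁻¹ ρ₂⁻¹ x) :=
    (((unitBump n).contDiff (n := 1)).differentiable one_ne_zero _).hasFDerivAt
  have h2 := (h1.comp x
    (LinearMap.toContinuousLinearMap (rescale n ρ₁⁻¹ ρ₂⁻¹)).hasFDerivAt).hasLineDerivAt
      (EuclideanSpace.single 0 1)
  convert! h2 using 1
  simp [beamBumpDeriv, rescale_single]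

lemma continuous_fderiv_unitBump : Continuous fun ξ : EuclideanSpace ℝ (Fin (n + 1)) =>
    fderiv ℝ (unitBump n) ξ (EuclideanSpace.single 0 1) :=
  (((unitBump n).contDiff (n := 1)).continuous_fderiv one_ne_zero).clm_apply continuous_const

lemma continuous_beamBumpDeriv : Continuous (beamBumpDeriv n ρ₁ ρ₂) :=
  (continuous_fderiv_unitBump.comp (continuous_rescale _ _)).const_mul _

lemma beamBump_nonneg (x : EuclideanSpace ℝ (Fin (n + 1))) : 0 ≤ beamBump n ρ₁ ρ₂ x :=
  (unitBump n).nonneg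

lemma beamBump_le_one (x : EuclideanSpace ℝ (Fin (n + 1))) : beamBump n ρ₁ ρ₂ x ≤ 1 :=
  (unitBump n).le_one

lemma tsupport_beamBump_subset : tsupport (beamBump n ρ₁ ρ₂) ⊆ beamTarget n ρ₁ ρ₂ := by
  refine (tsupport_comp_subset_preimage (unitBump n) (continuous_rescale _ _)).trans ?_
  rw [beamTarget, (unitBump n).tsupport_eq]
  exact preimage_mono (Metric.closedBall_subset_ball (by norm_num [unitBump]))

lemma beamBump_eq_zero {x : EuclideanSpace ℝ (Fin (n + 1))} (hx : x ∉ beamTarget n ρ₁ ρ₂) :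
    beamBump n ρ₁ ρ₂ x = 0 :=
  image_eq_zero_of_notMem_tsupport fun h => hx (tsupport_beamBump_subset h)

lemma beamBumpDeriv_eq_zero {x : EuclideanSpace ℝ (Fin (n + 1))} (hx : x ∉ beamTarget n ρ₁ ρ₂) :
    beamBumpDeriv n ρ₁ ρ₂ x = 0 := by
  rw [← (hasLineDerivAt_beamBump x).lineDeriv]
  have h : beamBump n ρ₁ ρ₂ =ᶠ[𝓝 x] fun _ => 0 :=
    notMem_tsupport_iff_eventuallyEq.1 fun h => hx (tsupport_beamBump_subset h)
  rw [h.lineDeriv_eq]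
  simp [lineDeriv]

lemma integral_unitBump_pos (n : ℕ) : 0 < ∫ ξ, unitBump n ξ :=
  (unitBump n).integral_pos

lemma integral_beamBump (h₁ : 0 < ρ₁) (h₂ : 0 < ρ₂) :
    ∫ x, beamBump n ρ₁ ρ₂ x = ρ₁ * ρ₂ ^ n * ∫ ξ, unitBump n ξ := by
  simpa [beamBump] using integral_rescale h₁ h₂ (unitBump n).continuous

lemma integral_abs_beamBumpDeriv (h₁ : 0 < ρ₁) (h₂ : 0 < ρ₂) :
    ∫ x, |beamBumpDeriv n ρ₁ ρ₂ x| = ρ₁ * ρ₂ ^ n *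
      (ρ₁⁻¹ * ∫ ξ, |fderiv ℝ (unitBump n) ξ (EuclideanSpace.single 0 1)|) := by
  have h := integral_rescale h₁ h₂ (continuous_fderiv_unitBump (n := n)).abs
  rw [smul_eq_mul] at h
  simp only [beamBumpDeriv, abs_mul, integral_const_mul, abs_of_pos (inv_pos.2 h₁), h]
  ring

lemma hasCompactSupport_beamBump (h : BeamScales g k ρ₁ ρ₂) :
    HasCompactSupport (beamBump n ρ₁ ρ₂) := by
  refine (isCompact_closedBall (0 : EuclideanSpace ℝ (Fin (n + 1))) (12 * ρ₁)).of_isClosed_subset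
    (isClosed_tsupport _) (tsupport_beamBump_subset.trans fun x hx => ?_)
  rw [mem_closedBall_zero_iff]
  exact norm_le_of_mem_beamTarget h hx

lemma hasCompactSupport_beamBumpDeriv (h : BeamScales g k ρ₁ ρ₂) :
    HasCompactSupport (beamBumpDeriv n ρ₁ ρ₂) := by
  refine HasCompactSupport.intro
    (isCompact_closedBall (0 : EuclideanSpace ℝ (Fin (n + 1))) (12 * ρ₁)) fun x hx =>
      beamBumpDeriv_eq_zero fun hQ => hx ?_
  rw [mem_closedBall_zero_iff]
  exact norm_le_of_mem_beamTarget h hQ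

/-- The factor `e^{-ikx₁}`. -/
noncomputable def conjWave (k : ℝ) (x : EuclideanSpace ℝ (Fin (n + 1))) : ℂ :=
  Complex.exp (-(Complex.I * ((k * x 0 : ℝ) : ℂ)))

lemma norm_conjWave (x : EuclideanSpace ℝ (Fin (n + 1))) : ‖conjWave k x‖ = 1 := by
  have : -(Complex.I * ((k * x 0 : ℝ) : ℂ)) = ((-(k * x 0) : ℝ) : ℂ) * Complex.I := by
    push_cast; ring
  rw [conjWave, this, Complex.norm_exp_ofReal_mul_I]

lemma continuous_conjWave : Continuous (conjWave k : EuclideanSpace ℝ (Fin (n + 1)) → ℂ) := by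
  unfold conjWave
  fun_prop

lemma conjWave_eq (x : EuclideanSpace ℝ (Fin (n + 1))) :
    conjWave k x = (Real.cos (k * x 0) : ℂ) - (Real.sin (k * x 0) : ℂ) * Complex.I := by
  have : -(Complex.I * ((k * x 0 : ℝ) : ℂ)) = ((-(k * x 0) : ℝ) : ℂ) * Complex.I := by
    push_cast; ring
  rw [conjWave, this, Complex.exp_mul_I, ← Complex.ofReal_cos, ← Complex.ofReal_sin, Real.cos_neg,
    Real.sin_neg]
  push_cast
  ring

/-- The complex test function `e^{-ikx₁} β`. -/
noncomputable def waveTest (n : ℕ) (k ρ₁ ρ₂ : ℝ) (x : EuclideanSpace ℝ (Fin (n + 1))) : ℂ :=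
  conjWave k x * (beamBump n ρ₁ ρ₂ x : ℂ)

/-- The derivative of `waveTest` in the direction of the beam. -/
noncomputable def waveTestDeriv (n : ℕ) (k ρ₁ ρ₂ : ℝ) (x : EuclideanSpace ℝ (Fin (n + 1))) : ℂ :=
  conjWave k x * ((beamBumpDeriv n ρ₁ ρ₂ x : ℂ) - Complex.I * k * (beamBump n ρ₁ ρ₂ x : ℂ))

/-- A function whose pairing with `e^{-ikx₁} β` is that of the derivative of `f` is at least
of the size of `k f`, if `f` oscillates like `e^{ikx₁}`. -/
lemma le_eLpNorm_of_waveTest (h : BeamScales g k ρ₁ ρ₂)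
    {f w : EuclideanSpace ℝ (Fin (n + 1)) → ℂ} {A A' : ℝ}
    (hf : AEStronglyMeasurable f (volume.restrict (beamTarget n ρ₁ ρ₂)))
    (hw : AEStronglyMeasurable w (volume.restrict (beamTarget n ρ₁ ρ₂)))
    (hlow : ∀ x ∈ beamTarget n ρ₁ ρ₂, A ≤ ((phaseConst n)⁻¹ * conjWave k x * f x).re)
    (hupp : ∀ x ∈ beamTarget n ρ₁ ρ₂, ‖f x‖ ≤ A')
    (hid : ∫ x in beamTarget n ρ₁ ρ₂, waveTestDeriv n k ρ₁ ρ₂ x * f x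
      = - ∫ x in beamTarget n ρ₁ ρ₂, waveTest n k ρ₁ ρ₂ x * w x) :
    ENNReal.ofReal (ρ₁ * ρ₂ ^ n * (k * A * (∫ ξ, unitBump n ξ)
        - A' * (ρ₁⁻¹ * ∫ ξ, |fderiv ℝ (unitBump n) ξ (EuclideanSpace.single 0 1)|)))
      ≤ eLpNorm w 2 (volume.restrict (beamTarget n ρ₁ ρ₂))
        * volume (beamTarget n ρ₁ ρ₂) ^ (1 / 2 : ℝ) := by
  have hρ := h.length_pos
  have hρ' := h.width_pos
  have hk := h.k_pos
  set Q := beamTarget n ρ₁ ρ₂ with hQ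
  have hQm : MeasurableSet Q := isOpen_beamTarget.measurableSet
  set F : EuclideanSpace ℝ (Fin (n + 1)) → ℂ := fun x => (phaseConst n)⁻¹ * conjWave k x * f x
    with hF
  have hFm : AEStronglyMeasurable F (volume.restrict Q) :=
    ((continuous_conjWave.aestronglyMeasurable).const_mul _).mul hf
  have hFn : ∀ x ∈ Q, ‖F x‖ ≤ A' := fun x hx => by
    simp only [hF, norm_mul, norm_inv, norm_phaseConst, norm_conjWave]
    simpa using hupp x hx
  have hβ : Integrable (fun x => beamBump n ρ₁ ρ₂ x) :=
    contDiff_beamBump.continuous.integrable_of_hasCompactSupport (hasCompactSupport_beamBump h)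
  have hβ' : Integrable (fun x => beamBumpDeriv n ρ₁ ρ₂ x) :=
    continuous_beamBumpDeriv.integrable_of_hasCompactSupport (hasCompactSupport_beamBumpDeriv h)
  have hFae : ∀ᵐ x ∂(volume.restrict Q), ‖F x‖ ≤ A' :=
    (ae_restrict_iff' hQm).2 (ae_of_all _ hFn)
  have hi1 : Integrable (fun x => (beamBump n ρ₁ ρ₂ x : ℂ) * F x) (volume.restrict Q) :=
    hβ.ofReal.restrict.mul_bdd hFm hFae
  have hi2 : Integrable (fun x => (beamBumpDeriv n ρ₁ ρ₂ x : ℂ) * F x) (volume.restrict Q) :=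
    hβ'.ofReal.restrict.mul_bdd hFm hFae
  have hsetβ : ∫ x in Q, beamBump n ρ₁ ρ₂ x = ∫ x, beamBump n ρ₁ ρ₂ x :=
    setIntegral_eq_integral_of_forall_compl_eq_zero fun x hx => beamBump_eq_zero hx
  have hsetβ' : ∫ x in Q, |beamBumpDeriv n ρ₁ ρ₂ x| = ∫ x, |beamBumpDeriv n ρ₁ ρ₂ x| :=
    setIntegral_eq_integral_of_forall_compl_eq_zero fun x hx => by
      rw [beamBumpDeriv_eq_zero hx, abs_zero]
  -- The bump is nonnegative, so the lower bound for the real part of $F$ survives integration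
  -- against it.
  have hlow' : A * ∫ x, beamBump n ρ₁ ρ₂ x ≤ ‖∫ x in Q, (beamBump n ρ₁ ρ₂ x : ℂ) * F x‖ := by
    refine le_trans ?_ (Complex.re_le_norm _)
    have h1 := integral_re hi1
    simp only [RCLike.re_to_complex] at h1
    rw [← h1, ← hsetβ, ← integral_const_mul]
    refine setIntegral_mono_on (hβ.restrict.const_mul _) hi1.re hQm fun x hx => ?_
    rw [Complex.re_ofReal_mul, mul_comm]
    exact mul_le_mul_of_nonneg_left (hlow x hx) (beamBump_nonneg x)
  have hupp' : ‖∫ x in Q, (beamBumpDeriv n ρ₁ ρ₂ x : ℂ) * F x‖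
      ≤ A' * ∫ x, |beamBumpDeriv n ρ₁ ρ₂ x| := by
    rw [← hsetβ', ← integral_const_mul]
    refine norm_integral_le_of_norm_le (hβ'.abs.restrict.const_mul _)
      ((ae_restrict_iff' hQm).2 (ae_of_all _ fun x hx => ?_))
    rw [norm_mul, Complex.norm_real, Real.norm_eq_abs, mul_comm]
    exact mul_le_mul_of_nonneg_right (hFn x hx) (abs_nonneg _)
  have hsplit : (phaseConst n)⁻¹ * ∫ x in Q, waveTestDeriv n k ρ₁ ρ₂ x * f x
      = (∫ x in Q, (beamBumpDeriv n ρ₁ ρ₂ x : ℂ) * F x)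
        - (Complex.I * k) * ∫ x in Q, (beamBump n ρ₁ ρ₂ x : ℂ) * F x := by
    rw [← integral_const_mul, ← integral_const_mul, ← integral_sub hi2 (hi1.const_mul _)]
    refine integral_congr_ae (ae_of_all _ fun x => ?_)
    simp only [hF, waveTestDeriv]
    ring
  -- Reverse triangle inequality: the term in which the derivative falls on $e^{-ikx_1}$ dominates
  -- the one in which it falls on the bump.
  have hnorm : k * (A * ∫ x, beamBump n ρ₁ ρ₂ x) - A' * ∫ x, |beamBumpDeriv n ρ₁ ρ₂ x|
      ≤ ‖∫ x in Q, waveTest n k ρ₁ ρ₂ x * w x‖ := by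
    have h1 : ‖(phaseConst n)⁻¹ * ∫ x in Q, waveTestDeriv n k ρ₁ ρ₂ x * f x‖
        = ‖∫ x in Q, waveTest n k ρ₁ ρ₂ x * w x‖ := by
      rw [hid, norm_mul, norm_inv, norm_phaseConst, norm_neg, inv_one, one_mul]
    rw [← h1, hsplit]
    have h2 := norm_sub_norm_le ((Complex.I * k) * ∫ x in Q, (beamBump n ρ₁ ρ₂ x : ℂ) * F x)
      (∫ x in Q, (beamBumpDeriv n ρ₁ ρ₂ x : ℂ) * F x)
    rw [norm_sub_rev] at h2
    refine le_trans ?_ h2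
    rw [norm_mul, norm_mul, Complex.norm_I, one_mul, Complex.norm_real, Real.norm_of_nonneg hk.le]
    have := mul_le_mul_of_nonneg_left hlow' hk.le
    linarith
  rw [integral_beamBump hρ hρ', integral_abs_beamBumpDeriv hρ hρ'] at hnorm
  calc ENNReal.ofReal (ρ₁ * ρ₂ ^ n * (k * A * (∫ ξ, unitBump n ξ)
        - A' * (ρ₁⁻¹ * ∫ ξ, |fderiv ℝ (unitBump n) ξ (EuclideanSpace.single 0 1)|)))
      ≤ ENNReal.ofReal ‖∫ x in Q, waveTest n k ρ₁ ρ₂ x * w x‖ :=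
        ENNReal.ofReal_le_ofReal (le_trans (le_of_eq (by ring)) hnorm)
    _ = ‖∫ x in Q, waveTest n k ρ₁ ρ₂ x * w x‖ₑ := ofReal_norm _
    _ ≤ ∫⁻ x in Q, ‖waveTest n k ρ₁ ρ₂ x * w x‖ₑ := enorm_integral_le_lintegral_enorm _
    _ ≤ ∫⁻ x in Q, ‖w x‖ₑ := by
        refine lintegral_mono fun x => ?_
        rw [← ofReal_norm, ← ofReal_norm]
        refine ENNReal.ofReal_le_ofReal ?_
        rw [norm_mul, waveTest, norm_mul, norm_conjWave, Complex.norm_real,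
          Real.norm_of_nonneg (beamBump_nonneg x), one_mul]
        exact mul_le_of_le_one_left (norm_nonneg _) (beamBump_le_one x)
    _ = eLpNorm w 1 (volume.restrict Q) := by rw [eLpNorm_one_eq_lintegral_enorm]
    _ ≤ _ := by
        -- Cauchy–Schwarz on the target, which has finite volume.
        refine (eLpNorm_le_eLpNorm_mul_rpow_measure_univ (p := 1) (q := 2) (by norm_num)
          hw).trans ?_
        rw [Measure.restrict_apply_univ]
        norm_num

end Duality

/-! ### Integration by parts for weak and classical derivatives -/

section Pairing

open Filter Topology

variable {n : ℕ} {g : EuclideanSpace ℝ (Fin (n + 1)) → ℝ} {k ρ₁ ρ₂ : ℝ} {χ : ℝ → ℝ}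
  {u : EuclideanSpace ℝ (Fin (n + 2)) → ℂ}

lemma hasLineDerivAt_cos_mul_beamBump (x : EuclideanSpace ℝ (Fin (n + 1))) :
    HasLineDerivAt ℝ (fun x => Real.cos (k * x 0) * beamBump n ρ₁ ρ₂ x)
      (-Real.sin (k * x 0) * k * beamBump n ρ₁ ρ₂ x + Real.cos (k * x 0) * beamBumpDeriv n ρ₁ ρ₂ x)
      x (EuclideanSpace.single 0 1) := by
  have h1 : HasDerivAt (fun t : ℝ =>
      k * (x + t • (EuclideanSpace.single 0 1 : EuclideanSpace ℝ (Fin (n + 1)))) 0) k 0 := by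
    simpa using ((hasDerivAt_id (0 : ℝ)).const_add (x 0)).const_mul k
  have h2 : HasDerivAt (fun t : ℝ => beamBump n ρ₁ ρ₂ (x + t • EuclideanSpace.single 0 1)) _ 0 :=
    hasLineDerivAt_beamBump x
  refine HasDerivAt.congr_deriv (h1.cos.mul h2) ?_
  simp

lemma hasLineDerivAt_sin_mul_beamBump (x : EuclideanSpace ℝ (Fin (n + 1))) :
    HasLineDerivAt ℝ (fun x => Real.sin (k * x 0) * beamBump n ρ₁ ρ₂ x)
      (Real.cos (k * x 0) * k * beamBump n ρ₁ ρ₂ x + Real.sin (k * x 0) * beamBumpDeriv n ρ₁ ρ₂ x)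
      x (EuclideanSpace.single 0 1) := by
  have h1 : HasDerivAt (fun t : ℝ =>
      k * (x + t • (EuclideanSpace.single 0 1 : EuclideanSpace ℝ (Fin (n + 1)))) 0) k 0 := by
    simpa using ((hasDerivAt_id (0 : ℝ)).const_add (x 0)).const_mul k
  have h2 : HasDerivAt (fun t : ℝ => beamBump n ρ₁ ρ₂ (x + t • EuclideanSpace.single 0 1)) _ 0 :=
    hasLineDerivAt_beamBump x
  refine HasDerivAt.congr_deriv (h1.sin.mul h2) ?_
  simp

lemma waveTest_eq (x : EuclideanSpace ℝ (Fin (n + 1))) :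
    waveTest n k ρ₁ ρ₂ x = ((Real.cos (k * x 0) * beamBump n ρ₁ ρ₂ x : ℝ) : ℂ)
      - Complex.I * ((Real.sin (k * x 0) * beamBump n ρ₁ ρ₂ x : ℝ) : ℂ) := by
  rw [waveTest, conjWave_eq]
  push_cast
  ring

lemma waveTestDeriv_eq (x : EuclideanSpace ℝ (Fin (n + 1))) :
    waveTestDeriv n k ρ₁ ρ₂ x
      = ((-Real.sin (k * x 0) * k * beamBump n ρ₁ ρ₂ x
          + Real.cos (k * x 0) * beamBumpDeriv n ρ₁ ρ₂ x : ℝ) : ℂ)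
        - Complex.I * ((Real.cos (k * x 0) * k * beamBump n ρ₁ ρ₂ x
          + Real.sin (k * x 0) * beamBumpDeriv n ρ₁ ρ₂ x : ℝ) : ℂ) := by
  rw [waveTestDeriv, conjWave_eq]
  push_cast
  linear_combination (Complex.sin (k * x 0) * k * beamBump n ρ₁ ρ₂ x : ℂ) * Complex.I_sq

lemma contDiff_coord_zero :
    ContDiff ℝ ∞ fun x : EuclideanSpace ℝ (Fin (n + 1)) => k * x 0 :=
  contDiff_const.mul (EuclideanSpace.proj (𝕜 := ℝ) (0 : Fin (n + 1))).contDiff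

lemma LocallyIntegrableOn.integrableOn_beamTarget (h : BeamScales g k ρ₁ ρ₂)
    {v : EuclideanSpace ℝ (Fin (n + 1)) → ℂ} (hv : LocallyIntegrableOn v (Metric.ball 0 1)) :
    IntegrableOn v (beamTarget n ρ₁ ρ₂) := by
  have h1 : IntegrableOn v (Metric.closedBall 0 (12 * ρ₁)) :=
    hv.integrableOn_compact_subset (Metric.closedBall_subset_ball h.length_lt)
      (isCompact_closedBall _ _)
  refine h1.mono_set fun x hx => ?_
  rw [mem_closedBall_zero_iff]
  exact norm_le_of_mem_beamTarget h hx

/-- Testing a weak derivative with a real function supported along the beam. -/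
lemma IsWeakCoordDeriv.setIntegral_eq (h : BeamScales g k ρ₁ ρ₂)
    {v w : EuclideanSpace ℝ (Fin (n + 2)) → ℂ} (hw : IsWeakCoordDeriv g 0 v w)
    {φ φ' : EuclideanSpace ℝ (Fin (n + 1)) → ℝ} (hφ : ContDiff ℝ ∞ φ)
    (hφ' : ∀ x, HasLineDerivAt ℝ φ (φ' x) x (EuclideanSpace.single 0 1))
    (hsupp : tsupport φ ⊆ tsupport (beamBump n ρ₁ ρ₂)) :
    Integrable (fun x => (φ' x : ℂ) * v (graphMap g x)) (volume.restrict (beamTarget n ρ₁ ρ₂)) ∧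
    Integrable (fun x => (φ x : ℂ) * w (graphMap g x)) (volume.restrict (beamTarget n ρ₁ ρ₂)) ∧
    ∫ x in beamTarget n ρ₁ ρ₂, (φ' x : ℂ) * v (graphMap g x)
      = - ∫ x in beamTarget n ρ₁ ρ₂, (φ x : ℂ) * w (graphMap g x) := by
  have hc : HasCompactSupport φ :=
    (hasCompactSupport_beamBump h).of_isClosed_subset (isClosed_tsupport _) hsupp
  have hfd : ∀ x, fderiv ℝ φ x (EuclideanSpace.single 0 1) = φ' x := fun x => by
    rw [← (hφ' x).lineDeriv]
    exact ((hφ.differentiable (by simp)) x).lineDeriv_eq_fderiv.symm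
  have hφ'eq : φ' = fun x => fderiv ℝ φ x (EuclideanSpace.single 0 1) :=
    funext fun x => (hfd x).symm
  have hφ'c : Continuous φ' := by
    rw [hφ'eq]
    exact (hφ.continuous_fderiv (by simp)).clm_apply continuous_const
  have hφ's : HasCompactSupport φ' := by
    rw [hφ'eq]
    exact hc.fderiv_apply (𝕜 := ℝ) _
  have hzero : ∀ x ∉ beamTarget n ρ₁ ρ₂, φ x = 0 := fun x hx =>
    image_eq_zero_of_notMem_tsupport fun h' => hx (tsupport_beamBump_subset (hsupp h'))
  have hzero' : ∀ x ∉ beamTarget n ρ₁ ρ₂, φ' x = 0 := fun x hx => by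
    rw [hφ'eq]
    have := image_eq_zero_of_notMem_tsupport (f := fderiv ℝ φ) fun h' =>
      hx (tsupport_beamBump_subset (hsupp (tsupport_fderiv_subset ℝ h')))
    simp [this]
  obtain ⟨C, hC⟩ := hc.exists_bound_of_continuous hφ.continuous
  obtain ⟨C', hC'⟩ := hφ's.exists_bound_of_continuous hφ'c
  refine ⟨?_, ?_, ?_⟩
  · exact (LocallyIntegrableOn.integrableOn_beamTarget h hw.1).bdd_mul (c := C')
      (Complex.continuous_ofReal.comp hφ'c).aestronglyMeasurable
      (ae_of_all _ fun x => by simpa using hC' x)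
  · exact (LocallyIntegrableOn.integrableOn_beamTarget h hw.2.1).bdd_mul (c := C)
      (Complex.continuous_ofReal.comp hφ.continuous).aestronglyMeasurable
      (ae_of_all _ fun x => by simpa using hC x)
  · have h1 := hw.2.2 φ hφ hc
      ((hsupp.trans tsupport_beamBump_subset).trans (beamTarget_subset_ball h))
    simp only [hfd] at h1
    rw [setIntegral_eq_integral_of_forall_compl_eq_zero fun x hx => by simp [hzero' x hx],
      setIntegral_eq_integral_of_forall_compl_eq_zero fun x hx => by simp [hzero x hx]]
    exact h1

/-- The definition of a weak derivative admits only real test functions, so $e^{-ikx_1}\beta$ is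
split into its cosine and sine parts. -/
lemma IsWeakCoordDeriv.waveTest_pairing (h : BeamScales g k ρ₁ ρ₂)
    {v w : EuclideanSpace ℝ (Fin (n + 2)) → ℂ} (hw : IsWeakCoordDeriv g 0 v w) :
    ∫ x in beamTarget n ρ₁ ρ₂, waveTestDeriv n k ρ₁ ρ₂ x * v (graphMap g x)
      = - ∫ x in beamTarget n ρ₁ ρ₂, waveTest n k ρ₁ ρ₂ x * w (graphMap g x) := by
  have hx := contDiff_coord_zero (n := n) (k := k)
  obtain ⟨h1, h2, h3⟩ := hw.setIntegral_eq h
    (φ := fun x => Real.cos (k * x 0) * beamBump n ρ₁ ρ₂ x)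
    ((Real.contDiff_cos.comp hx).mul contDiff_beamBump) hasLineDerivAt_cos_mul_beamBump
    (tsupport_mul_subset_right ..)
  obtain ⟨h4, h5, h6⟩ := hw.setIntegral_eq h
    (φ := fun x => Real.sin (k * x 0) * beamBump n ρ₁ ρ₂ x)
    ((Real.contDiff_sin.comp hx).mul contDiff_beamBump) hasLineDerivAt_sin_mul_beamBump
    (tsupport_mul_subset_right ..)
  simp only [waveTest_eq, waveTestDeriv_eq, sub_mul, mul_assoc Complex.I]
  rw [integral_sub h1 (h4.const_mul _), integral_sub h2 (h5.const_mul _), integral_const_mul,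
    integral_const_mul, h3, h6]
  ring

lemma hasLineDerivAt_waveTest (x : EuclideanSpace ℝ (Fin (n + 1))) :
    HasLineDerivAt ℝ (waveTest n k ρ₁ ρ₂) (waveTestDeriv n k ρ₁ ρ₂ x) x
      (EuclideanSpace.single 0 1) := by
  set e : EuclideanSpace ℝ (Fin (n + 1)) := EuclideanSpace.single 0 1
  have h1 : HasDerivAt (fun t : ℝ => Real.cos (k * (x + t • e) 0)
      * beamBump n ρ₁ ρ₂ (x + t • e)) _ 0 :=
    hasLineDerivAt_cos_mul_beamBump x
  have h2 : HasDerivAt (fun t : ℝ => Real.sin (k * (x + t • e) 0)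
      * beamBump n ρ₁ ρ₂ (x + t • e)) _ 0 :=
    hasLineDerivAt_sin_mul_beamBump x
  rw [waveTestDeriv_eq]
  refine HasDerivAt.congr_of_eventuallyEq
    (h1.ofReal_comp.sub (h2.ofReal_comp.const_mul Complex.I)) ?_
  exact Eventually.of_forall fun t => waveTest_eq _

lemma continuous_waveTest : Continuous (waveTest n k ρ₁ ρ₂) :=
  continuous_conjWave.mul (Complex.continuous_ofReal.comp contDiff_beamBump.continuous)

lemma continuous_waveTestDeriv : Continuous (waveTestDeriv n k ρ₁ ρ₂) := by
  have h1 := contDiff_beamBump (n := n) (ρ₁ := ρ₁) (ρ₂ := ρ₂) |>.continuous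
  have h2 := continuous_beamBumpDeriv (n := n) (ρ₁ := ρ₁) (ρ₂ := ρ₂)
  have h3 := continuous_conjWave (n := n) (k := k)
  unfold waveTestDeriv
  fun_prop

/-- A line derivative of a measurable function is measurable where it exists. -/
lemma aestronglyMeasurable_lineDeriv {E : Type*} [NormedAddCommGroup E] [NormedSpace ℝ E]
    [MeasurableSpace E] [BorelSpace E] {μ : Measure E} {f f' : E → ℂ} {v : E} {s : Set E}
    (hs : MeasurableSet s) (hf : Measurable f) (hf' : ∀ x ∈ s, HasLineDerivAt ℝ f (f' x) x v) :
    AEStronglyMeasurable f' (μ.restrict s) := by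
  -- Difference quotients along a sequence of steps are measurable and converge to the line
  -- derivative on $s$.
  have hlim : Tendsto (fun m : ℕ => ((m : ℝ) + 1)⁻¹) atTop (𝓝[≠] 0) := by
    refine tendsto_nhdsWithin_iff.2 ⟨?_, Eventually.of_forall fun m => ?_⟩
    · simpa using tendsto_one_div_add_atTop_nhds_zero_nat (𝕜 := ℝ)
    · have : (0 : ℝ) < ((m : ℝ) + 1)⁻¹ := by positivity
      exact this.ne'
  refine aestronglyMeasurable_of_tendsto_ae atTop
    (f := fun (m : ℕ) x => (((m : ℝ) + 1)⁻¹)⁻¹ • (f (x + (((m : ℝ) + 1)⁻¹) • v) - f x)) ?_ ?_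
  · intro m
    refine Measurable.aestronglyMeasurable ?_
    exact ((hf.comp (measurable_id.add_const _)).sub hf).const_smul ((((m : ℝ) + 1)⁻¹)⁻¹)
  · refine (ae_restrict_iff' hs).2 (ae_of_all _ fun x hx => ?_)
    have h1 := (hasDerivAt_iff_tendsto_slope_zero.1 (hf' x hx)).comp hlim
    simpa [Function.comp_def] using h1

lemma coordDeriv_graphMap (v : EuclideanSpace ℝ (Fin (n + 2)) → ℂ)
    (x : EuclideanSpace ℝ (Fin (n + 1))) :
    coordDeriv g 0 v (graphMap g x)
      = lineDeriv ℝ (fun x => v (graphMap g x)) x (EuclideanSpace.single 0 1) := by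
  rw [coordDeriv, tangentialPart_graphMap]

/-- The support of the test function lies in the target, so $f$ has to be differentiable only there
and the values of $f'$ elsewhere play no role. -/
lemma waveTest_pairing_of_hasLineDerivAt (h : BeamScales g k ρ₁ ρ₂)
    {f f' : EuclideanSpace ℝ (Fin (n + 1)) → ℂ} {A C : ℝ} (hf : Measurable f)
    (hA : ∀ x ∈ beamTarget n ρ₁ ρ₂, ‖f x‖ ≤ A)
    (hf' : ∀ x ∈ beamTarget n ρ₁ ρ₂, HasLineDerivAt ℝ f (f' x) x (EuclideanSpace.single 0 1))
    (hC : ∀ x ∈ beamTarget n ρ₁ ρ₂, ‖f' x‖ ≤ C) :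
    ∫ x in beamTarget n ρ₁ ρ₂, waveTestDeriv n k ρ₁ ρ₂ x * f x
      = - ∫ x in beamTarget n ρ₁ ρ₂, waveTest n k ρ₁ ρ₂ x * f' x := by
  set Q := beamTarget n ρ₁ ρ₂ with hQ
  have hQm : MeasurableSet Q := isOpen_beamTarget.measurableSet
  have hz : ∀ x ∉ Q, waveTest n k ρ₁ ρ₂ x = 0 := fun x hx => by
    simp [waveTest, beamBump_eq_zero hx]
  have hz' : ∀ x ∉ Q, waveTestDeriv n k ρ₁ ρ₂ x = 0 := fun x hx => by
    simp [waveTestDeriv, beamBump_eq_zero hx, beamBumpDeriv_eq_zero hx]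
  have hts : tsupport (waveTest n k ρ₁ ρ₂) ⊆ Q := by
    have h1 : tsupport (fun x => (beamBump n ρ₁ ρ₂ x : ℂ)) ⊆ tsupport (beamBump n ρ₁ ρ₂) :=
      closure_mono fun x hx hx' => hx (by simp [hx'])
    exact ((tsupport_mul_subset_right ..).trans h1).trans tsupport_beamBump_subset
  have hball : ∀ x, x ∉ Metric.closedBall (0 : EuclideanSpace ℝ (Fin (n + 1))) (12 * ρ₁) →
      x ∉ Q := fun x hx hx' => hx (by
    rw [mem_closedBall_zero_iff]
    exact norm_le_of_mem_beamTarget h hx')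
  have hi : Integrable (waveTest n k ρ₁ ρ₂) :=
    continuous_waveTest.integrable_of_hasCompactSupport
      (HasCompactSupport.intro (isCompact_closedBall 0 (12 * ρ₁)) fun x hx => hz x (hball x hx))
  have hi' : Integrable (waveTestDeriv n k ρ₁ ρ₂) :=
    continuous_waveTestDeriv.integrable_of_hasCompactSupport
      (HasCompactSupport.intro (isCompact_closedBall 0 (12 * ρ₁)) fun x hx => hz' x (hball x hx))
  have hglob : ∀ {φ w : EuclideanSpace ℝ (Fin (n + 1)) → ℂ} {M : ℝ}, Integrable φ →
      (∀ x ∉ Q, φ x = 0) → AEStronglyMeasurable w (volume.restrict Q) → (∀ x ∈ Q, ‖w x‖ ≤ M) →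
      Integrable fun x => φ x * w x := by
    intro φ w M h1 h2 h3 h4
    refine (integrableOn_iff_integrable_of_support_subset (s := Q) fun x hx => ?_).1
      (h1.restrict.mul_bdd h3 ((ae_restrict_iff' hQm).2 (ae_of_all _ h4)))
    by_contra hx'
    exact hx (by simp [h2 x hx'])
  have key := integral_bilinear_hasLineDerivAt_right_eq_neg_left_of_integrable
    (μ := (volume : Measure (EuclideanSpace ℝ (Fin (n + 1))))) (B := ContinuousLinearMap.mul ℝ ℂ)
    (f := waveTest n k ρ₁ ρ₂) (f' := waveTestDeriv n k ρ₁ ρ₂) (g := f) (g' := f')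
    (v := EuclideanSpace.single 0 1)
    (hglob hi' hz' hf.aestronglyMeasurable hA)
    (hglob hi hz (aestronglyMeasurable_lineDeriv hQm hf hf') hC)
    (hglob hi hz hf.aestronglyMeasurable hA)
    (fun x _ => hasLineDerivAt_waveTest x) (fun x hx => hf' x (hts hx))
  simp only [ContinuousLinearMap.mul_apply'] at key
  rw [setIntegral_eq_integral_of_forall_compl_eq_zero fun x hx => by simp [hz' x hx],
    setIntegral_eq_integral_of_forall_compl_eq_zero fun x hx => by simp [hz x hx], key, neg_neg]

end Pairing

/-! ### Lower bounds for a general beam -/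

section LowerBounds

open Filter Topology

variable {n : ℕ} {χ : ℝ → ℝ}

lemma volume_beamTarget {ρ₁ ρ₂ : ℝ} (h₁ : 0 < ρ₁) (h₂ : 0 < ρ₂) :
    volume (beamTarget n ρ₁ ρ₂) ^ (1 / 2 : ℝ) = ENNReal.ofReal (Real.sqrt (ρ₁ * ρ₂ ^ n)
      * Real.sqrt (volume.real (Metric.ball (EuclideanSpace.single 0 10 :
        EuclideanSpace ℝ (Fin (n + 1))) 1))) := by
  rw [beamTarget, volume_rescale_preimage h₁ h₂ Metric.isOpen_ball.measurableSet,
    ← ENNReal.ofReal_toReal (Metric.isBounded_ball.measure_lt_top (μ := volume)).ne,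
    ← ENNReal.ofReal_mul (by positivity), ENNReal.ofReal_rpow_of_nonneg (by positivity)
    (by norm_num), ← Real.sqrt_eq_rpow, Real.sqrt_mul (by positivity)]
  rfl

/-- The single-layer potential of a beam, and its derivative along the beam, are not small. -/
theorem exists_singleLayer_beam_lower_bound (n : ℕ) (hχ : Continuous χ)
    (hs : tsupport χ ⊆ Icc (-2) 2) (h0 : ∀ t, 0 ≤ χ t) (h1 : ∀ t ∈ Icc (-1 : ℝ) 1, χ t = 1) :
    ∃ c > 0, ∃ K₀ : ℝ, ∀ (g : EuclideanSpace ℝ (Fin (n + 1)) → ℝ) (k ρ₁ ρ₂ : ℝ)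
      (u : EuclideanSpace ℝ (Fin (n + 2)) → ℂ), BeamScales g k ρ₁ ρ₂ → K₀ ≤ k * ρ₁ →
      IsBeam g χ k ρ₁ ρ₂ u →
      ENNReal.ofReal (c * (amplitude n k (14 * ρ₁) * (ρ₁ * ρ₂ ^ n))) * l2Norm g u
        ≤ l2Norm g (singleLayer g k u) ∧
      ENNReal.ofReal (c * (k * (amplitude n k (14 * ρ₁) * (ρ₁ * ρ₂ ^ n)))) * l2Norm g u
        ≤ l2Norm g (coordDeriv g 0 (singleLayer g k u)) ∧
      ∀ w, IsWeakCoordDeriv g 0 (singleLayer g k u) w →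
        ENNReal.ofReal (c * (k * (amplitude n k (14 * ρ₁) * (ρ₁ * ρ₂ ^ n)))) * l2Norm g u
          ≤ l2Norm g w := by
  obtain ⟨Z, hZ⟩ := exists_normalizedHankel_near_one n
  obtain ⟨M, hM0, hM⟩ := exists_envelope_le hχ hs h0
  set I₀ := ∫ ξ, unitBump n ξ with hI₀
  set I₁ := ∫ ξ, |fderiv ℝ (unitBump n) ξ (EuclideanSpace.single 0 1)| with hI₁
  have hI₀pos : 0 < I₀ := integral_unitBump_pos n
  set τ := (volume (Metric.ball (0 : EuclideanSpace ℝ (Fin (n + 1))) 1)).toReal with hτ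
  set τ' := volume.real (Metric.ball (EuclideanSpace.single 0 10 :
    EuclideanSpace ℝ (Fin (n + 1))) 1) with hτ'
  set τ₃ := (volume (Metric.closedBall (0 : EuclideanSpace ℝ (Fin (n + 1))) 3)).toReal with hτ₃
  have hτpos : 0 < τ := ENNReal.toReal_pos (Metric.measure_ball_pos volume _ one_pos).ne'
    Metric.isBounded_ball.measure_lt_top.ne
  have hτ'pos : 0 < τ' := ENNReal.toReal_pos (Metric.measure_ball_pos volume _ one_pos).ne'
    Metric.isBounded_ball.measure_lt_top.ne
  have hτ₃pos : 0 < τ₃ := ENNReal.toReal_pos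
    (Metric.measure_closedBall_pos volume _ (by norm_num)).ne'
    Metric.isBounded_closedBall.measure_lt_top.ne
  set U := M * Real.sqrt (3 ^ (n + 1) * τ₃) with hU
  have hUpos : 0 < U := by positivity
  set T : ℝ := 3 * 2 ^ (((n : ℝ) + 1) / 2) with hT
  have hTpos : 0 < T := by positivity
  -- The first entry serves the bound for $S_ku$, the second the bound for its derivative, where
  -- half of $I_0$ is given up to absorb the term with the derivative of the bump.
  set c := min (τ / 2 * Real.sqrt τ' / U) (τ / 2 * (I₀ / 2) / (U * Real.sqrt τ')) with hc
  have hcpos : 0 < c := by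
    refine lt_min ?_ ?_ <;> positivity
  -- Beyond $Z$ the normalised Hankel integral is within $1/4$ of 1. Beyond $2TI_1/I_0$ the term
  -- with the derivative of the bump is at most half of the main term.
  refine ⟨c, hcpos, max Z (2 * T * I₁ / I₀), fun g k ρ₁ ρ₂ u h hK hu => ?_⟩
  have hρ := h.length_pos
  have hρ' := h.width_pos
  have hk := h.k_pos
  have hkZ : Z ≤ k * ρ₁ := (le_max_left _ _).trans hK
  set V := ρ₁ * ρ₂ ^ n with hV
  have hVpos : 0 < V := by positivity
  set a := amplitude n k (14 * ρ₁) with ha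
  have hapos : 0 < a := amplitude_pos n hk (by positivity)
  set A := beamSize g χ k ρ₁ ρ₂ with hA
  have hAlow : τ / 2 * (a * V) ≤ A := by
    have := le_integral_envelope h hχ hs h0 h1
    rw [hA, beamSize]
    calc τ / 2 * (a * V) = 1 / 2 * a * (V * τ) := by ring
      _ ≤ _ := by gcongr
  have hApos : 0 < A := lt_of_lt_of_le (by positivity) hAlow
  have hu2 : l2Norm g u ≤ ENNReal.ofReal (U * Real.sqrt V) := by
    refine (l2Norm_beam_le h hs h0 hu (hM n ρ₁ ρ₂)).trans_eq ?_
    rw [← ENNReal.ofReal_toReal (Metric.isBounded_closedBall.measure_lt_top (μ := volume)).ne,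
      ← hτ₃, show (3 : ℝ≥0∞) ^ (n + 1) = ENNReal.ofReal (3 ^ (n + 1)) by
        rw [ENNReal.ofReal_pow (by norm_num)]; simp,
      ← ENNReal.ofReal_mul (by positivity), ← ENNReal.ofReal_mul (by positivity),
      ENNReal.ofReal_rpow_of_nonneg (by positivity) (by norm_num), ← ENNReal.ofReal_mul hM0.le,
      ← Real.sqrt_eq_rpow, hU, mul_assoc M, ← Real.sqrt_mul (by positivity)]
    congr 3
    ring
  have hvol := volume_beamTarget (n := n) hρ hρ'
  rw [← hτ', ← hV] at hvol
  -- Only the pairing identity with the modulated bump matters, so this serves the classical and the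
  -- weak derivatives at once.
  have hderiv : ∀ w : EuclideanSpace ℝ (Fin (n + 2)) → ℂ,
      AEStronglyMeasurable (fun x => w (graphMap g x)) (volume.restrict (beamTarget n ρ₁ ρ₂)) →
      ∫ x in beamTarget n ρ₁ ρ₂, waveTestDeriv n k ρ₁ ρ₂ x * singleLayer g k u (graphMap g x)
        = - ∫ x in beamTarget n ρ₁ ρ₂, waveTest n k ρ₁ ρ₂ x * w (graphMap g x) →
      ENNReal.ofReal (c * (k * (a * V))) * l2Norm g u ≤ l2Norm g w := by
    intro w hw hid
    have key := le_eLpNorm_of_waveTest h (f := fun x => singleLayer g k u (graphMap g x))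
      (measurable_singleLayer_graphMap h hχ hu).aestronglyMeasurable hw
      (fun x hx => beamSize_le_re h hZ hkZ hχ hs h0 hu hx)
      (fun x hx => norm_singleLayer_le h hZ hkZ hχ hs h0 hu hx) hid
    rw [hvol, ← hV, ← hI₀, ← hI₁, ← hT, ← hA] at key
    have hD : ENNReal.ofReal (Real.sqrt V * Real.sqrt τ') ≠ 0 := by
      rw [Ne, ENNReal.ofReal_eq_zero, not_le]
      positivity
    refine le_trans ?_ (eLpNorm_beamTarget_le h w)
    refine (ENNReal.mul_le_mul_iff_left hD ENNReal.ofReal_ne_top).1 (le_trans ?_ key)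
    calc ENNReal.ofReal (c * (k * (a * V))) * l2Norm g u
          * ENNReal.ofReal (Real.sqrt V * Real.sqrt τ')
        ≤ ENNReal.ofReal (c * (k * (a * V))) * ENNReal.ofReal (U * Real.sqrt V)
          * ENNReal.ofReal (Real.sqrt V * Real.sqrt τ') := by gcongr
      _ = ENNReal.ofReal (c * (U * Real.sqrt τ') * (k * (a * V) * V)) := by
          rw [← ENNReal.ofReal_mul (by positivity), ← ENNReal.ofReal_mul (by positivity)]
          congr 1
          linear_combination (c * k * a * V * U * Real.sqrt τ') * Real.mul_self_sqrt hVpos.le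
      _ ≤ _ := by
          refine ENNReal.ofReal_le_ofReal ?_
          have hc2 : c * (U * Real.sqrt τ') ≤ τ / 2 * (I₀ / 2) := by
            rw [← le_div_iff₀ (by positivity)]
            exact min_le_right _ _
          have hT' : T * A * (ρ₁⁻¹ * I₁) ≤ k * A * (I₀ / 2) := by
            have h2 : 2 * T * I₁ / I₀ ≤ k * ρ₁ := (le_max_right _ _).trans hK
            rw [div_le_iff₀ hI₀pos] at h2
            have h3 : T * I₁ * ρ₁⁻¹ ≤ k * (I₀ / 2) := by
              rw [← div_eq_mul_inv, div_le_iff₀ hρ]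
              linarith
            nlinarith
          calc c * (U * Real.sqrt τ') * (k * (a * V) * V)
              ≤ τ / 2 * (I₀ / 2) * (k * (a * V) * V) := by gcongr
            _ = V * (k * (τ / 2 * (a * V)) * (I₀ / 2)) := by ring
            _ ≤ V * (k * A * (I₀ / 2)) := by gcongr
            _ ≤ V * (k * A * I₀ - T * A * (ρ₁⁻¹ * I₁)) := by
                gcongr
                linarith
  refine ⟨?_, ?_, ?_⟩
  · refine le_trans ?_ (eLpNorm_beamTarget_le h _)
    have hlow : eLpNorm (fun _ : EuclideanSpace ℝ (Fin (n + 1)) => A) 2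
        (volume.restrict (beamTarget n ρ₁ ρ₂)) ≤ eLpNorm (fun x => singleLayer g k u (graphMap g x))
          2 (volume.restrict (beamTarget n ρ₁ ρ₂)) := by
      refine eLpNorm_mono_ae ((ae_restrict_iff' isOpen_beamTarget.measurableSet).2
        (ae_of_all _ fun x hx => ?_))
      rw [Real.norm_of_nonneg hApos.le, ← norm_phase_mul n (k * x 0)]
      exact (beamSize_le_re h hZ hkZ hχ hs h0 hu hx).trans (Complex.re_le_norm _)
    refine le_trans ?_ hlow
    rw [eLpNorm_const' _ (by norm_num) (by norm_num), Measure.restrict_apply_univ,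
      ENNReal.toReal_ofNat, hvol, Real.enorm_of_nonneg hApos.le, ← ENNReal.ofReal_mul hApos.le]
    calc ENNReal.ofReal (c * (a * V)) * l2Norm g u
        ≤ ENNReal.ofReal (c * (a * V)) * ENNReal.ofReal (U * Real.sqrt V) := by gcongr
      _ = ENNReal.ofReal (c * U * (a * V) * Real.sqrt V) := by
          rw [← ENNReal.ofReal_mul (by positivity)]
          congr 1
          ring
      _ ≤ _ := by
          refine ENNReal.ofReal_le_ofReal ?_
          have hc1 : c * U ≤ τ / 2 * Real.sqrt τ' := by
            rw [← le_div_iff₀ hUpos]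
            exact min_le_left _ _
          calc c * U * (a * V) * Real.sqrt V ≤ τ / 2 * Real.sqrt τ' * (a * V) * Real.sqrt V := by
                gcongr
            _ = τ / 2 * (a * V) * (Real.sqrt V * Real.sqrt τ') := by ring
            _ ≤ _ := by gcongr
  · obtain ⟨C, hC⟩ := exists_hasLineDerivAt_singleLayer h hZ hkZ hχ hs h0 hu
    have hline : ∀ x ∈ beamTarget n ρ₁ ρ₂,
        HasLineDerivAt ℝ (fun x => singleLayer g k u (graphMap g x))
          (coordDeriv g 0 (singleLayer g k u) (graphMap g x)) x (EuclideanSpace.single 0 1) ∧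
        ‖coordDeriv g 0 (singleLayer g k u) (graphMap g x)‖ ≤ C := fun x hx => by
      obtain ⟨D, hD, hDC⟩ := hC x hx
      rw [coordDeriv_graphMap, hD.lineDeriv]
      exact ⟨hD, hDC⟩
    have hmeas := measurable_singleLayer_graphMap h hχ hu
    exact hderiv _
      (aestronglyMeasurable_lineDeriv isOpen_beamTarget.measurableSet hmeas
        fun x hx => (hline x hx).1)
      (waveTest_pairing_of_hasLineDerivAt h hmeas
        (fun x hx => norm_singleLayer_le h hZ hkZ hχ hs h0 hu hx)
        (fun x hx => (hline x hx).1) (fun x hx => (hline x hx).2))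
  · intro w hw
    exact hderiv w (LocallyIntegrableOn.integrableOn_beamTarget h hw.2.1).aestronglyMeasurable
      (hw.waveTest_pairing h)

/-! ### Powers of $k$ for the test functions -/

lemma isBeam_testFun (g : EuclideanSpace ℝ (Fin (n + 1)) → ℝ) (χ : ℝ → ℝ) (ε γ₁ γ₂ : ℝ) {k : ℝ}
    (hk : 0 ≤ k) :
    IsBeam g χ k (ε * k ^ (-γ₁)) (ε * k ^ (-γ₂)) (testFun n χ ε γ₁ γ₂ k) := by
  intro y
  have h1 : graphMap g y 0 = y 0 := graphMap_castSucc (g := g) y 0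
  have h2 : ∀ i : Fin n, graphMap g y i.succ.castSucc = y i.succ := fun i =>
    graphMap_castSucc y _
  simp only [testFun, h1, h2, envelope, Real.rpow_neg hk, div_eq_mul_inv, mul_inv, inv_inv]
  have h3 : y 0 * ε⁻¹ * k ^ γ₁ = y 0 * (ε⁻¹ * k ^ γ₁) := by ring
  rw [h3, mul_comm (ε⁻¹ * k ^ γ₂)]

/-- The amplitude scales like $k^{n\gamma_2+(\gamma_1-1)/2}$ and the volume like
$k^{-\gamma_1-n\gamma_2}$. The dimension cancels and $-(1+\gamma_1)/2=-\gamma_2$ remains. -/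
lemma amplitude_mul_volume (n : ℕ) {ε γ₁ γ₂ : ℝ} (hε : 0 < ε) (hγ : 1 + γ₁ = 2 * γ₂) :
    ∃ C > 0, ∀ k > 0, amplitude n k (14 * (ε * k ^ (-γ₁)))
      * (ε * k ^ (-γ₁) * (ε * k ^ (-γ₂)) ^ n) = C * k ^ (-γ₂) := by
  refine ⟨1 / 4 * ((28 * Real.pi * ε)⁻¹) ^ ((n : ℝ) / 2) * Real.sqrt ((7 * Real.pi * ε)⁻¹)
    * (ε * ε ^ n), by positivity, fun k hk => ?_⟩
  have e1 : k / (2 * Real.pi * (14 * (ε * k ^ (-γ₁)))) = (28 * Real.pi * ε)⁻¹ * k ^ (2 * γ₂) := by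
    rw [← hγ, Real.rpow_add hk, Real.rpow_one, Real.rpow_neg hk.le]
    field_simp
    norm_num
  have e2 : 2 / (Real.pi * (k * (14 * (ε * k ^ (-γ₁)))))
      = (7 * Real.pi * ε)⁻¹ * (k ^ (γ₁ - 1)) := by
    rw [Real.rpow_sub hk, Real.rpow_one, Real.rpow_neg hk.le]
    field_simp
    norm_num
  rw [amplitude, e1, e2, Real.mul_rpow (by positivity) (by positivity),
    Real.sqrt_mul (by positivity), Real.sqrt_eq_rpow (k ^ (γ₁ - 1)), mul_pow,
    ← Real.rpow_natCast (k ^ (-γ₂)) n, ← Real.rpow_mul hk.le, ← Real.rpow_mul hk.le,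
    ← Real.rpow_mul hk.le]
  have e3 : k ^ (-γ₂) = k ^ (2 * γ₂ * (n / 2)) * k ^ ((γ₁ - 1) * (1 / 2)) * k ^ (-γ₁)
      * k ^ (-γ₂ * n) := by
    rw [← Real.rpow_add hk, ← Real.rpow_add hk, ← Real.rpow_add hk]
    congr 1
    linear_combination (1 / 2) * hγ
  rw [e3]
  ring

/-- The relation between the exponents gives $k\rho_2^2=\epsilon\rho_1$ exactly, so the transverse
condition is just smallness of $\epsilon$. The width stays below the length since $\gamma_1<1$
forces $\gamma_1\le\gamma_2$. -/
lemma beamScales_of_le {g : EuclideanSpace ℝ (Fin (n + 1)) → ℝ} {ε γ₁ γ₂ k : ℝ}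
    (hg : Differentiable ℝ g)
    (hL : ∀ x ∈ Metric.ball 0 1, ∀ y ∈ Metric.ball 0 1, |g x - g y| ≤ 2 * dist x y)
    (hγ : 1 + γ₁ = 2 * γ₂) (hγ₁ : 0 ≤ γ₁) (hγ₁' : γ₁ < 1) (hε : ε ∈ Ioo (0 : ℝ) (1 / 100))
    (hk : 1 ≤ k) (hkε : 1 ≤ k * (ε * k ^ (-γ₁)))
    (hN : ∀ x y, ‖x‖ ≤ 12 * (ε * k ^ (-γ₁)) → ‖y‖ ≤ 12 * (ε * k ^ (-γ₁)) →
      k * (g x - g y) ^ 2 ≤ ε * k ^ (-γ₁) / 4) :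
    BeamScales g k (ε * k ^ (-γ₁)) (ε * k ^ (-γ₂)) := by
  have hk0 : 0 < k := by linarith
  have hε0 := hε.1
  refine ⟨hg, hL, hk0, by positivity, ?_, ?_, hkε, ?_, hN⟩
  · gcongr
    linarith
  · have : k ^ (-γ₁) ≤ 1 := Real.rpow_le_one_of_one_le_of_nonpos hk (by linarith)
    nlinarith [hε.2]
  · have : k * (ε * k ^ (-γ₂)) ^ 2 = ε * (ε * k ^ (-γ₁)) := by
      have h1 : k ^ (-γ₁) = k * (k ^ (-γ₂)) ^ 2 := by
        rw [← Real.rpow_natCast, ← Real.rpow_mul hk0.le]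
        nth_rewrite 2 [← Real.rpow_one k]
        rw [← Real.rpow_add hk0]
        congr 1
        push_cast
        linarith
      rw [h1]
      ring
    rw [this]
    have h2 : 0 < ε * k ^ (-γ₁) := by positivity
    nlinarith [hε.2]

/-- The lower bounds for beams with length `ε k^{-γ₁}` and width `ε k^{-γ₂}`. -/
theorem testFun_lower_bounds (n : ℕ) (hχ : Continuous χ)
    (hs : tsupport χ ⊆ Icc (-2) 2) (h0 : ∀ t, 0 ≤ χ t) (h1 : ∀ t ∈ Icc (-1 : ℝ) 1, χ t = 1)
    {g : EuclideanSpace ℝ (Fin (n + 1)) → ℝ} {γ₁ γ₂ : ℝ} (hg : Differentiable ℝ g)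
    (hL : ∀ x ∈ Metric.ball 0 1, ∀ y ∈ Metric.ball 0 1, |g x - g y| ≤ 2 * dist x y)
    (hγ : 1 + γ₁ = 2 * γ₂) (hγ₁ : 0 ≤ γ₁) (hγ₁' : γ₁ < 1)
    (hN : ∀ ε ∈ Ioo (0 : ℝ) (1 / 100), ∀ k ≥ 1, ∀ x y, ‖x‖ ≤ 12 * (ε * k ^ (-γ₁)) →
      ‖y‖ ≤ 12 * (ε * k ^ (-γ₁)) → k * (g x - g y) ^ 2 ≤ ε * k ^ (-γ₁) / 4) :
    ∃ ε₀ > (0 : ℝ), ∀ ε ∈ Ioo 0 ε₀, ∃ c > (0 : ℝ), ∃ k₀ > (0 : ℝ), ∀ k ≥ k₀,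
      MemLp (testFun n χ ε γ₁ γ₂ k) 2 (surfaceMeasure g) ∧
      0 < l2Norm g (testFun n χ ε γ₁ γ₂ k) ∧
      ENNReal.ofReal (c * k ^ (-γ₂)) * l2Norm g (testFun n χ ε γ₁ γ₂ k)
        ≤ l2Norm g (singleLayer g k (testFun n χ ε γ₁ γ₂ k)) ∧
      ENNReal.ofReal (c * k ^ (1 - γ₂)) * l2Norm g (testFun n χ ε γ₁ γ₂ k)
        ≤ l2Norm g (coordDeriv g 0 (singleLayer g k (testFun n χ ε γ₁ γ₂ k))) ∧
      ∀ w, IsWeakCoordDeriv g 0 (singleLayer g k (testFun n χ ε γ₁ γ₂ k)) w →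
        ENNReal.ofReal (c * k ^ (1 - γ₂)) * l2Norm g (testFun n χ ε γ₁ γ₂ k) ≤ l2Norm g w := by
  obtain ⟨c, hc, K₀, hK⟩ := exists_singleLayer_beam_lower_bound n hχ hs h0 h1
  refine ⟨1 / 100, by norm_num, fun ε hε => ?_⟩
  have hε0 := hε.1
  obtain ⟨C, hC, hCk⟩ := amplitude_mul_volume n hε0 hγ
  -- The beam becomes long compared with the wavelength because $\gamma_1<1$, so every threshold on
  -- $k\rho_1$ is eventually passed.
  have hlim : Tendsto (fun k : ℝ => k * (ε * k ^ (-γ₁))) atTop atTop := by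
    have h2 : Tendsto (fun k : ℝ => ε * k ^ (1 - γ₁)) atTop atTop :=
      (tendsto_rpow_atTop (by linarith)).const_mul_atTop hε0
    refine h2.congr' ?_
    filter_upwards [eventually_gt_atTop 0] with k hk
    rw [sub_eq_add_neg, Real.rpow_add hk, Real.rpow_one]
    ring
  obtain ⟨k₁, hk₁⟩ := eventually_atTop.1
    ((hlim.eventually_ge_atTop (max 1 K₀)).and (eventually_ge_atTop 1))
  refine ⟨c * C, by positivity, max k₁ 1, by positivity, fun k hk => ?_⟩
  obtain ⟨h2, h3⟩ := hk₁ k ((le_max_left _ _).trans hk)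
  have hk0 : 0 < k := by linarith
  have hB := beamScales_of_le hg hL hγ hγ₁ hγ₁' hε h3 ((le_max_left _ _).trans h2) (hN ε hε k h3)
  have hu := isBeam_testFun g χ ε γ₁ γ₂ hk0.le
  obtain ⟨h4, h5, h6⟩ := hK g k _ _ _ hB ((le_max_right _ _).trans h2) hu
  have h7 : k * (C * k ^ (-γ₂)) = C * k ^ (1 - γ₂) := by
    rw [sub_eq_add_neg, Real.rpow_add hk0, Real.rpow_one]
    ring
  rw [hCk k hk0] at h4 h5 h6
  rw [h7] at h5 h6
  simp only [mul_assoc]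
  exact ⟨memLp_beam hB hχ hs h0 hu, l2Norm_beam_pos hB hχ h0 h1 hu, h4, h5, h6⟩

/-! ### Optimality of the exponent -/

/-- The infimum runs over families of weak derivatives and each member obeys the bound. If there is
no such family the infimum is $\infty$, so existence need not be discussed. -/
lemma le_h1Norm {m : ℕ} {g : EuclideanSpace ℝ (Fin m) → ℝ} (i : Fin m)
    {v : EuclideanSpace ℝ (Fin (m + 1)) → ℂ} {a : ℝ≥0∞}
    (h : ∀ w, IsWeakCoordDeriv g i v w → a ≤ l2Norm g w) : a ≤ h1Norm g v := by
  refine le_iInf₂ fun w hw => ?_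
  calc a ≤ l2Norm g (w i) := h _ (hw i)
    _ = (l2Norm g (w i) ^ (2 : ℝ)) ^ (1 / 2 : ℝ) := by
        rw [← ENNReal.rpow_mul]
        norm_num
    _ ≤ _ := by
        gcongr
        exact (Finset.single_le_sum (f := fun i => l2Norm g (w i) ^ (2 : ℝ))
          (fun _ _ => zero_le) (Finset.mem_univ i)).trans le_add_self

/-- No bound `C k^s log k` with `s < δ` dominates `c k^δ`. -/
lemma le_of_rpow_le_rpow_mul_log {c δ s C k₀ : ℝ} (hc : 0 < c)
    (h : ∀ k ≥ k₀, c * k ^ δ ≤ C * k ^ s * Real.log k) : δ ≤ s := by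
  by_contra! hs
  -- This constant turns $C\log k$ into at most $\tfrac c2k^{\delta-s}$, half of what the hypothesis
  -- requires.
  have h1 := (isLittleO_log_rpow_atTop (sub_pos.2 hs)).bound
    (show 0 < c / (2 * (|C| + 1)) by positivity)
  obtain ⟨k, hk, hk0, hk1⟩ := (h1.and ((eventually_ge_atTop k₀).and (eventually_gt_atTop 1))).exists
  have hk2 : 0 < k := by linarith
  have h2 := h k hk0
  rw [Real.norm_eq_abs, abs_of_pos (Real.log_pos hk1), Real.norm_of_nonneg (by positivity)] at hk
  have h3 : k ^ δ = k ^ s * k ^ (δ - s) := by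
    rw [← Real.rpow_add hk2]
    congr 1
    ring
  have hks : 0 < k ^ s := by positivity
  have hkd : 0 < k ^ (δ - s) := by positivity
  have h4 : C * Real.log k ≤ (|C| + 1) * (c / (2 * (|C| + 1)) * k ^ (δ - s)) := by
    have := Real.log_pos hk1
    calc C * Real.log k ≤ (|C| + 1) * Real.log k := by
          gcongr
          linarith [le_abs_self C]
      _ ≤ _ := by gcongr
  have h5 : (|C| + 1) * (c / (2 * (|C| + 1)) * k ^ (δ - s)) = c / 2 * k ^ (δ - s) := by
    field_simp
  rw [h5] at h4
  rw [h3] at h2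
  have h6 : k ^ s * (c * k ^ (δ - s)) ≤ k ^ s * (C * Real.log k) := by linarith
  have h7 := le_of_mul_le_mul_left h6 hks
  nlinarith

/-- Optimality of the power of `k` in the bound for the single-layer operator. -/
theorem L2H1Bound.exponent_le {g : EuclideanSpace ℝ (Fin (n + 1)) → ℝ} {δ s C k₀ c k₁ : ℝ}
    (hb : L2H1Bound g s C k₀) (hc : 0 < c) {u : ℝ → EuclideanSpace ℝ (Fin (n + 2)) → ℂ}
    (hu : ∀ k ≥ k₁, MemLp (u k) 2 (surfaceMeasure g) ∧ 0 < l2Norm g (u k) ∧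
      ∀ w, IsWeakCoordDeriv g 0 (singleLayer g k (u k)) w →
        ENNReal.ofReal (c * k ^ δ) * l2Norm g (u k) ≤ l2Norm g w) : δ ≤ s := by
  refine le_of_rpow_le_rpow_mul_log (C := C) (k₀ := max 1 (max k₀ k₁)) hc fun k hk => ?_
  have hk1 : 1 ≤ k := (le_max_left _ _).trans hk
  have hk0 : k₀ ≤ k := (le_max_left _ _).trans ((le_max_right _ _).trans hk)
  obtain ⟨h1, h2, h3⟩ := hu k ((le_max_right _ _).trans ((le_max_right _ _).trans hk))
  have h4 := (le_h1Norm 0 h3).trans (hb k hk0 (u k) h1)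
  -- Cancelling the norm of the source needs it to be neither 0 nor $\infty$.
  have h5 := (ENNReal.mul_le_mul_iff_left h2.ne' h1.eLpNorm_lt_top.ne).1 h4
  have hpos : 0 < c * k ^ δ := by positivity
  by_contra! hlt
  -- `ENNReal.ofReal` sends nonpositive numbers to 0, so a nonpositive right-hand side is treated
  -- apart; it contradicts positivity of the left.
  rcases le_or_gt (C * k ^ s * Real.log k) 0 with hle | hgt
  · rw [ENNReal.ofReal_of_nonpos hle] at h5
    exact (ENNReal.ofReal_pos.2 hpos).not_ge h5
  · exact (((ENNReal.ofReal_lt_ofReal_iff hpos).2 hlt).not_ge) h5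

/-! ### The paraboloid and the two cases of the theorem -/

lemma paraboloidProfile_lipschitz (n : ℕ) : ∀ x ∈ Metric.ball 0 1, ∀ y ∈ Metric.ball 0 1,
    |paraboloidProfile n x - paraboloidProfile n y| ≤ 2 * dist x y := by
  intro x hx y hy
  rw [mem_ball_zero_iff] at hx hy
  have h1 := abs_norm_sub_norm_le x y
  rw [paraboloidProfile, paraboloidProfile, sq_sub_sq, abs_mul, dist_eq_norm,
    abs_of_nonneg (by positivity)]
  gcongr
  linarith

/-- Heights along the beam are at most $144\rho^2$, so the left side is at most
$144^2(k\rho^3)\rho$. The exponent $1/3$ is what makes $k\rho^3=\epsilon^3$ independent of $k$, and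
$144^2\cdot10^{-6}<1/4$. -/
lemma paraboloidProfile_normal (n : ℕ) : ∀ ε ∈ Ioo (0 : ℝ) (1 / 100), ∀ k ≥ 1, ∀ x y,
    ‖x‖ ≤ 12 * (ε * k ^ (-(1 / 3) : ℝ)) → ‖y‖ ≤ 12 * (ε * k ^ (-(1 / 3) : ℝ)) →
    k * (paraboloidProfile n x - paraboloidProfile n y) ^ 2 ≤ ε * k ^ (-(1 / 3) : ℝ) / 4 := by
  intro ε hε k hk x y hx hy
  have hk0 : 0 < k := by linarith
  have hε0 := hε.1
  set ρ := ε * k ^ (-(1 / 3) : ℝ) with hρ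
  have hρ0 : 0 < ρ := by positivity
  have h1 : k * ρ ^ 3 = ε ^ 3 := by
    have h2 : (k ^ (-(1 / 3) : ℝ)) ^ 3 = k⁻¹ := by
      rw [← Real.rpow_natCast, ← Real.rpow_mul hk0.le, ← Real.rpow_neg_one]
      norm_num
    rw [hρ, mul_pow, h2]
    field_simp
  have h3 : |‖x‖ ^ 2 - ‖y‖ ^ 2| ≤ 144 * ρ ^ 2 := by
    rw [abs_le]
    constructor <;> nlinarith [norm_nonneg x, norm_nonneg y]
  have h4 : (‖x‖ ^ 2 - ‖y‖ ^ 2) ^ 2 ≤ (144 * ρ ^ 2) ^ 2 := sq_le_sq' (abs_le.1 h3).1 (abs_le.1 h3).2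
  have h5 : ε ^ 3 ≤ (1 / 100) ^ 3 := by
    gcongr
    exact hε.2.le
  calc k * (paraboloidProfile n x - paraboloidProfile n y) ^ 2
      ≤ k * (144 * ρ ^ 2) ^ 2 := mul_le_mul_of_nonneg_left h4 hk0.le
    _ = 20736 * (k * ρ ^ 3) * ρ := by ring
    _ ≤ ρ / 4 := by
        rw [h1]
        nlinarith

end LowerBounds

end SingleLayer

theorem mainTheorem8 (n : ℕ) (χ : ℝ → ℝ) (hχ_smooth : ContDiff ℝ ∞ χ)
    (hχ_supp : tsupport χ ⊆ Set.Icc (-2) 2) (hχ_one : ∀ t ∈ Set.Icc (-1 : ℝ) 1, χ t = 1)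
    (hχ_nonneg : ∀ t, 0 ≤ χ t) :
    -- flat case
    ((∃ ε₀ > (0 : ℝ), ∀ ε ∈ Set.Ioo 0 ε₀, ∃ c > (0 : ℝ), ∃ k₀ > (0 : ℝ), ∀ k ≥ k₀,
        MeasureTheory.MemLp (testFun n χ ε 0 (1 / 2) k) 2 (surfaceMeasure (flatProfile n)) ∧
        0 < l2Norm (flatProfile n) (testFun n χ ε 0 (1 / 2) k) ∧
        ENNReal.ofReal (c * k ^ (-(1 / 2) : ℝ)) * l2Norm (flatProfile n) (testFun n χ ε 0 (1 / 2) k)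
          ≤ l2Norm (flatProfile n) (singleLayer (flatProfile n) k (testFun n χ ε 0 (1 / 2) k)) ∧
        ENNReal.ofReal (c * k ^ (1 / 2 : ℝ)) * l2Norm (flatProfile n) (testFun n χ ε 0 (1 / 2) k)
          ≤ l2Norm (flatProfile n)
              (coordDeriv (flatProfile n) 0 (singleLayer (flatProfile n) k (testFun n χ ε 0 (1 / 2) k))) ∧
        ∀ w, IsWeakCoordDeriv (flatProfile n) 0
            (singleLayer (flatProfile n) k (testFun n χ ε 0 (1 / 2) k)) w →
          ENNReal.ofReal (c * k ^ (1 / 2 : ℝ)) * l2Norm (flatProfile n) (testFun n χ ε 0 (1 / 2) k)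
            ≤ l2Norm (flatProfile n) w) ∧
      ∀ s C k₀ : ℝ, L2H1Bound (flatProfile n) s C k₀ → 1 / 2 ≤ s) ∧
    -- curved case
    ((∃ ε₀ > (0 : ℝ), ∀ ε ∈ Set.Ioo 0 ε₀, ∃ c > (0 : ℝ), ∃ k₀ > (0 : ℝ), ∀ k ≥ k₀,
        MeasureTheory.MemLp (testFun n χ ε (1 / 3) (2 / 3) k) 2 (surfaceMeasure (paraboloidProfile n)) ∧
        0 < l2Norm (paraboloidProfile n) (testFun n χ ε (1 / 3) (2 / 3) k) ∧
        ENNReal.ofReal (c * k ^ (-(2 / 3) : ℝ)) * l2Norm (paraboloidProfile n) (testFun n χ ε (1 / 3) (2 / 3) k)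
          ≤ l2Norm (paraboloidProfile n) (singleLayer (paraboloidProfile n) k (testFun n χ ε (1 / 3) (2 / 3) k)) ∧
        ENNReal.ofReal (c * k ^ (1 / 3 : ℝ)) * l2Norm (paraboloidProfile n) (testFun n χ ε (1 / 3) (2 / 3) k)
          ≤ l2Norm (paraboloidProfile n)
              (coordDeriv (paraboloidProfile n) 0 (singleLayer (paraboloidProfile n) k (testFun n χ ε (1 / 3) (2 / 3) k))) ∧
        ∀ w, IsWeakCoordDeriv (paraboloidProfile n) 0
            (singleLayer (paraboloidProfile n) k (testFun n χ ε (1 / 3) (2 / 3) k)) w →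
          ENNReal.ofReal (c * k ^ (1 / 3 : ℝ)) * l2Norm (paraboloidProfile n) (testFun n χ ε (1 / 3) (2 / 3) k)
            ≤ l2Norm (paraboloidProfile n) w) ∧
      ∀ s C k₀ : ℝ, L2H1Bound (paraboloidProfile n) s C k₀ → 1 / 3 ≤ s) := by

  have hc := hχ_smooth.continuous
  constructor
  -- Without curvature the normal condition holds trivially, so the beam may have length independent
  -- of $k$.
  · have h := testFun_lower_bounds n hc hχ_supp hχ_nonneg hχ_one (g := flatProfile n) (γ₁ := 0)
      (γ₂ := 1 / 2) (differentiable_const _)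
      (fun x _ y _ => by simp [flatProfile]) (by norm_num) le_rfl one_pos
      (fun ε hε k hk x y _ _ => by
        have := hε.1
        have : 0 < k := by linarith
        simp only [flatProfile, sub_self, ne_eq, OfNat.ofNat_ne_zero, not_false_eq_true, zero_pow,
          mul_zero]
        positivity)
    rw [show (1 : ℝ) - 1 / 2 = 1 / 2 by norm_num] at h
    refine ⟨h, fun s C k₀ hb => ?_⟩
    obtain ⟨ε₀, hε₀, h⟩ := h
    obtain ⟨c, hc, k₁, -, h⟩ := h (ε₀ / 2) ⟨by positivity, by linarith⟩
    exact hb.exponent_le hc fun k hk => ⟨(h k hk).1, (h k hk).2.1, (h k hk).2.2.2.2⟩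
  -- Curvature forces length $\epsilon k^{-1/3}$, and $1+\gamma_1=2\gamma_2$ then fixes
  -- $\gamma_2=2/3$.
  · have h := testFun_lower_bounds n hc hχ_supp hχ_nonneg hχ_one (g := paraboloidProfile n)
      (γ₁ := 1 / 3) (γ₂ := 2 / 3) (differentiable_id.norm_sq ℝ) (paraboloidProfile_lipschitz n)
      (by norm_num) (by norm_num) (by norm_num) (paraboloidProfile_normal n)
    rw [show (1 : ℝ) - 2 / 3 = 1 / 3 by norm_num] at h
    refine ⟨h, fun s C k₀ hb => ?_⟩
    obtain ⟨ε₀, hε₀, h⟩ := h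
    obtain ⟨c, hc, k₁, -, h⟩ := h (ε₀ / 2) ⟨by positivity, by linarith⟩
    exact hb.exponent_le hc fun k hk => ⟨(h k hk).1, (h k hk).2.1, (h k hk).2.2.2.2⟩
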